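/- Let $k$ be a field. For a finite simplicial complex $\Delta$ of dimension $d-1$ whose vertex set $V$ has $n$ elements, let $S=k[x_v : v\in V]$, let $I_\Delta\subseteq S$ be the Stanley–Reisner ideal (generated by the squarefree monomials $\prod_{v\in F}x_v$ of the nonfaces $F$), let $c=\operatorname{codim}(\Delta)=n-d$, and define the modified type and the type defect of $\Delta$ by $$\operatorname{type}(\Delta)=\dim_k \operatorname{Tor}_c^S(S/I_\Delta,k)-\dim_k \operatorname{Tor}_c^S(S/I_\Delta,k)_c,\qquad \operatorname{td}(\Delta)=\operatorname{type}(\Delta)-c,$$ where $M_c$ denotes the degree $c$ component of a graded module $M$. Call $\Delta$ Cohen–Macaulay if the ring $S/I_\Delta$ is Cohen–Macaulay. Theorem. Let $\Delta_1$ and $\Delta_2$ be Cohen–Macaulay complexes of dimension $d-1$ on disjoint vertex sets, and let $E_1$ and $E_2$ be $(\ell-1)$-dimensional faces of $\Delta_1$ and $\Delta_2$, respectively (the empty face, $\ell=0$, is allowed). Let $\Delta=\Delta_1\sqcup_{E_1=E_2}\Delta_2$ be the complex obtained by identifying $E_1$ with $E_2$ along a bijection, let $n$ be the number of vertices of $\Delta$,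 and let $c=n-d$. Then $$\operatorname{type}(\Delta)=\operatorname{type}(\Delta_1)+\operatorname{type}(\Delta_2)+\binom{n-\ell}{c+1}$$ and $$\operatorname{td}(\Delta)=\operatorname{td}(\Delta_1)+\operatorname{td}(\Delta_2)-d+\ell+\binom{n-\ell}{c+1}.$$ In particular, if $\ell\ge d-1$, then $\operatorname{td}(\Delta)=\operatorname{td}(\Delta_1)+\operatorname{td}(\Delta_2)$. -/

import Mathlib

/-! ## Graded Tor of a polynomial ring against its residue field -/

namespace GradedTor

open MvPolynomial

section Koszul

variable (k : Type*) [Field k] (V : Type*)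
variable (M : Type*) [AddCommGroup M] [Module (MvPolynomial V k) M]
  [Module k M] [IsScalarTower k (MvPolynomial V k) M]

/-- The `i`-th term of the Koszul complex `M ⊗_S K(x_v : v ∈ V)`, where `S = k[x_v : v ∈ V]`, `V` is
finite: it is `M ⊗_k ⋀^i (k^V)^*`, in the form of the alternating `i`-linear maps `k^V × ⋯ × k^V → M`. -/
abbrev Chain (i : ℕ) : Type _ := (V → k) [⋀^Fin i]→ₗ[k] M

instance (i : ℕ) : IsScalarTower k (MvPolynomial V k) (Chain k V M i) where
  smul_assoc a p ω := by ext u; simp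

variable [Fintype V] [DecidableEq V]

/-- The Koszul differential, `d ω = ∑ v, x_v · ω(e_v, -)`. -/
noncomputable def diff (i : ℕ) : Chain k V M (i + 1) →ₗ[MvPolynomial V k] Chain k V M i where
  toFun ω := ∑ v : V, (X v : MvPolynomial V k) • ω.curryLeft (Pi.single v 1)
  map_add' ω η := by
    simp [AlternatingMap.curryLeft_add, smul_add, Finset.sum_add_distrib]
  map_smul' a ω := by
    simp only [RingHom.id_apply, Finset.smul_sum]
    refine Finset.sum_congr rfl fun v _ => ?_
    ext u
    simp [smul_smul, mul_comm]

/-- The cycles in homological degree `i` (everything if `i = 0`). -/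
noncomputable def cycles : (i : ℕ) → Submodule (MvPolynomial V k) (Chain k V M i)
  | 0 => ⊤
  | i + 1 => LinearMap.ker (diff k V M i)

/-- The boundaries in homological degree `i`. -/
noncomputable def boundaries (i : ℕ) : Submodule (MvPolynomial V k) (Chain k V M i) :=
  LinearMap.range (diff k V M i)

/-- `Tor_i^S(M, k)` for `S = k[x_v : v ∈ V]` and `k = S / (x_v : v ∈ V)`: the homology of `M ⊗_S K`,
where `K` is the Koszul complex of the variables, the graded free resolution of `k` over `S`. That
`K` resolves `k` is proved below (`cycles_eq_boundaries`, `mem_boundaries_zero_iff`). -/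
abbrev Tor (i : ℕ) : Type _ :=
  cycles k V M i ⧸ (boundaries k V M i).submoduleOf (cycles k V M i)

variable {M}

/-- The degree `j` part of the chains in homological degree `i`, when `M` is graded with
homogeneous parts `𝓜 j`. The free generators in homological degree `i` have internal degree `i`. -/
def chainDegree (𝓜 : ℤ → Submodule k M) (i : ℕ) (j : ℤ) : Submodule k (Chain k V M i) where
  carrier := {ω | ∀ u, ω u ∈ 𝓜 (j - i)}
  add_mem' h h' u := (𝓜 _).add_mem (h u) (h' u)
  zero_mem' _ := (𝓜 _).zero_mem
  smul_mem' a _ h u := (𝓜 _).smul_mem a (h u)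

/-- `Tor_i^S(M, k)_j`, the degree `j` part of `Tor_i^S(M, k)`: the classes of the cycles that are
homogeneous of degree `j`. -/
noncomputable def torDegree (𝓜 : ℤ → Submodule k M) (i : ℕ) (j : ℤ) : Submodule k (Tor k V M i) :=
  ((chainDegree k V 𝓜 i j).comap ((cycles k V M i).subtype.restrictScalars k)).map
    (((boundaries k V M i).submoduleOf (cycles k V M i)).mkQ.restrictScalars k)

end Koszul

set_option linter.unusedSectionVars false

section Resolution

variable {k : Type*} [Field k] {V : Type*} [Fintype V] [DecidableEq V]

section Complex

variable {M : Type*} [AddCommGroup M] [Module (MvPolynomial V k) M]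
  [Module k M] [IsScalarTower k (MvPolynomial V k) M]

theorem sum_apply {ι : Type*} (s : Finset ι) {i : ℕ} (ω : ι → Chain k V M i)
    (u : Fin i → V → k) : (∑ j ∈ s, ω j) u = ∑ j ∈ s, ω j u :=
  map_sum ({ toFun := fun η => η u, map_zero' := rfl, map_add' := fun _ _ => rfl } :
    Chain k V M i →+ M) ω s

theorem diff_apply (i : ℕ) (ω : Chain k V M (i + 1)) :
    diff k V M i ω = ∑ v : V, (X v : MvPolynomial V k) • ω.curryLeft (Pi.single v 1) := rfl

theorem diff_diff (i : ℕ) (ω : Chain k V M (i + 2)) : diff k V M i (diff k V M (i + 1) ω) = 0 := by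
  have key : ∀ v w : V, (ω.curryLeft (Pi.single v 1)).curryLeft (Pi.single w 1) =
      -(ω.curryLeft (Pi.single w 1)).curryLeft (Pi.single v 1) := by
    intro v w
    have h := AlternatingMap.curryLeft_same ω (Pi.single v (1 : k) + Pi.single w 1)
    simp only [map_add, AlternatingMap.curryLeft_add, LinearMap.add_apply,
      AlternatingMap.curryLeft_same, zero_add, add_zero] at h
    first
    | exact eq_neg_of_add_eq_zero_left h
    | exact eq_neg_of_add_eq_zero_right h
  have h0 : diff k V M i (diff k V M (i + 1) ω) = ∑ v : V, ∑ w : V,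
      (X v * X w : MvPolynomial V k) •
        (ω.curryLeft (Pi.single v 1)).curryLeft (Pi.single w 1) := by
    rw [diff_apply (i + 1), map_sum]
    refine Finset.sum_congr rfl fun v _ => ?_
    rw [map_smul, diff_apply, Finset.smul_sum]
    exact Finset.sum_congr rfl fun w _ => smul_smul _ _ _
  rw [h0, ← Finset.sum_product']
  refine Finset.sum_involution (fun a _ => (a.2, a.1)) ?_ ?_ ?_ ?_
  · rintro ⟨v, w⟩ _
    simp only
    rw [key w v, mul_comm, smul_neg, add_neg_cancel]
  · rintro ⟨v, w⟩ _ hne h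
    simp only [Prod.mk.injEq] at h
    obtain rfl := h.1
    exact hne (by simp [AlternatingMap.curryLeft_same])
  · simp
  · simp

theorem boundaries_le_cycles (i : ℕ) : boundaries k V M i ≤ cycles k V M i := by
  cases i with
  | zero => exact le_top
  | succ i =>
    rintro _ ⟨ω, rfl⟩
    exact diff_diff i ω

/-- The exterior product with the coordinate form `e_w^*`. -/
noncomputable def wedge (w : V) {i : ℕ} (ω : Chain k V M i) : Chain k V M (i + 1) :=
  AlternatingMap.alternatizeUncurryFin ((LinearMap.proj w : (V → k) →ₗ[k] k).smulRight ω)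

theorem wedge_apply (w : V) {i : ℕ} (ω : Chain k V M i) (u : Fin (i + 1) → V → k) :
    wedge w ω u = ∑ j : Fin (i + 1), (-1) ^ (j : ℕ) • (u j w • ω (j.removeNth u)) := by
  simp [wedge, AlternatingMap.alternatizeUncurryFin_apply]

theorem wedge_zero (w : V) (i : ℕ) : wedge w (0 : Chain k V M i) = 0 := by
  ext u; simp [wedge_apply]

theorem wedge_neg (w : V) {i : ℕ} (ω : Chain k V M i) : wedge w (-ω) = -wedge w ω := by
  ext u; simp [wedge_apply]

theorem wedge_sum_smul (w : V) {i : ℕ} (a : V → MvPolynomial V k) (ω : V → Chain k V M i) :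
    wedge w (∑ v, a v • ω v) = ∑ v, a v • wedge w (ω v) := by
  ext u
  simp only [wedge_apply, sum_apply, AlternatingMap.smul_apply, Finset.smul_sum]
  rw [Finset.sum_comm]
  refine Finset.sum_congr rfl fun v _ => Finset.sum_congr rfl fun j _ => ?_
  rw [smul_comm (u j w), smul_comm ((-1 : ℤ) ^ (j : ℕ))]

theorem curryLeft_wedge (w : V) {i : ℕ} (ω : Chain k V M (i + 1)) (x : V → k) :
    (wedge w ω).curryLeft x = x w • ω - wedge w (ω.curryLeft x) := by
  ext u
  rw [AlternatingMap.curryLeft_apply_apply, wedge_apply, Fin.sum_univ_succ, AlternatingMap.sub_apply,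
    wedge_apply, sub_eq_add_neg, ← Finset.sum_neg_distrib]
  congr 1
  · simp [Matrix.vecCons]
  · refine Finset.sum_congr rfl fun j _ => ?_
    have : (Fin.succ j).removeNth (Matrix.vecCons x u) = Matrix.vecCons x (j.removeNth u) := by
      funext l
      refine Fin.cases ?_ (fun l => ?_) l <;> simp [Fin.removeNth, Matrix.vecCons]
    rw [this, AlternatingMap.curryLeft_apply_apply]
    simp [pow_succ]

theorem curryLeft_wedge_zero (w : V) (ω : Chain k V M 0) (x : V → k) :
    (wedge w ω).curryLeft x = x w • ω := by
  ext u
  rw [AlternatingMap.curryLeft_apply_apply, wedge_apply]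
  rw [Fin.sum_univ_succ, Subsingleton.elim (Fin.removeNth 0 (Matrix.vecCons x u)) u]
  simp

theorem curryLeft_curryLeft_of_eq_zero {i : ℕ} (ω : Chain k V M (i + 2)) (x y : V → k)
    (h : ω.curryLeft x = 0) : (ω.curryLeft y).curryLeft x = 0 := by
  have h' := AlternatingMap.curryLeft_same ω (x + y)
  simp only [map_add, AlternatingMap.curryLeft_same, zero_add, add_zero, h] at h'
  exact h'

theorem curryLeft_sub_wedge_self (w : V) {i : ℕ} (ψ : Chain k V M (i + 1)) :
    (ψ - wedge w (ψ.curryLeft (Pi.single w 1))).curryLeft (Pi.single w 1) = 0 := by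
  have hs : ∀ a b : Chain k V M (i + 1), (a - b).curryLeft = a.curryLeft - b.curryLeft := by
    intro a b; exact map_sub AlternatingMap.curryLeftLinearMap a b
  rw [hs, LinearMap.sub_apply]
  cases i with
  | zero => rw [curryLeft_wedge_zero]; simp
  | succ i => rw [curryLeft_wedge, AlternatingMap.curryLeft_same, wedge_zero]; simp

theorem curryLeft_sub_wedge_of_ne {t w : V} (htw : t ≠ w) {i : ℕ} (ψ : Chain k V M (i + 1))
    (h : ψ.curryLeft (Pi.single t 1) = 0) :
    (ψ - wedge w (ψ.curryLeft (Pi.single w 1))).curryLeft (Pi.single t 1) = 0 := by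
  have hs : ∀ a b : Chain k V M (i + 1), (a - b).curryLeft = a.curryLeft - b.curryLeft := by
    intro a b; exact map_sub AlternatingMap.curryLeftLinearMap a b
  rw [hs, LinearMap.sub_apply, h]
  cases i with
  | zero => rw [curryLeft_wedge_zero]; simp [htw.symm]
  | succ i =>
    rw [curryLeft_wedge, curryLeft_curryLeft_of_eq_zero _ _ _ h, wedge_zero]
    simp [htw.symm]

end Complex

/-- Division by the variable `x_w`, dropping the monomials not divisible by it. -/
noncomputable def divX (w : V) : MvPolynomial V k →ₗ[k] MvPolynomial V k where
  toFun p := p.divMonomial (Finsupp.single w 1)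
  map_add' p q := add_divMonomial p q _
  map_smul' a p := by ext m; simp [coeff_divMonomial]

theorem divX_X_mul_self (w : V) (p : MvPolynomial V k) : divX w (X w * p) = p :=
  X_mul_divMonomial w p

theorem divX_X_mul_of_ne {v w : V} (h : v ≠ w) (p : MvPolynomial V k) :
    divX w (X v * p) = X v * divX w p := by
  ext m
  simp only [divX, LinearMap.coe_mk, AddHom.coe_mk, coeff_divMonomial, coeff_X_mul']
  have : v ∈ (Finsupp.single w 1 + m).support ↔ v ∈ m.support := by
    simp [h.symm]
  simp only [this]
  split_ifs with hv
  · congr 1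
    refine (add_tsub_assoc_of_le ?_ _)
    simpa [Nat.one_le_iff_ne_zero] using hv
  · rfl

theorem exists_sub_diff (i : ℕ) (w : V) (T : Finset V) (ω : Chain k V (MvPolynomial V k) (i + 1))
    (hω : diff k V _ i ω = 0) (hT : ∀ t ∈ T, ω.curryLeft (Pi.single t 1) = 0) :
    ∃ η, ∀ t ∈ insert w T,
      (ω - diff k V _ (i + 1) η).curryLeft (Pi.single t 1) = 0 := by
  set A : Chain k V (MvPolynomial V k) (i + 1) := (divX w).compAlternatingMap ω with hA
  set ψ := ω - (X w : MvPolynomial V k) • A with hψ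
  have hAc : ∀ x, A.curryLeft x = (divX w).compAlternatingMap (ω.curryLeft x) := fun x =>
    AlternatingMap.curryLeft_compAlternatingMap _ _ _
  have hψc : ∀ x, ψ.curryLeft x = ω.curryLeft x - (X w : MvPolynomial V k) • A.curryLeft x := by
    intro x; ext u; simp [hψ]
  have hdA : diff k V _ i A = -ψ.curryLeft (Pi.single w 1) := by
    have h1 : (divX w).compAlternatingMap (diff k V _ i ω) = 0 := by rw [hω]; ext; simp
    ext1 u
    have h2 := congrArg (fun f => f u) h1
    rw [hψc]
    simp only [diff_apply, LinearMap.compAlternatingMap_apply, sum_apply,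
      AlternatingMap.smul_apply, map_sum, smul_eq_mul, AlternatingMap.zero_apply,
      AlternatingMap.neg_apply, AlternatingMap.sub_apply, hAc] at h2 ⊢
    rw [← Finset.add_sum_erase _ _ (Finset.mem_univ w)] at h2 ⊢
    rw [divX_X_mul_self] at h2
    have h3 : ∑ v ∈ Finset.univ.erase w, divX w (X v * (ω.curryLeft (Pi.single v 1)) u) =
        ∑ v ∈ Finset.univ.erase w, X v * divX w ((ω.curryLeft (Pi.single v 1)) u) :=
      Finset.sum_congr rfl fun v hv => divX_X_mul_of_ne (Finset.ne_of_mem_erase hv) _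
    rw [h3] at h2
    linear_combination h2
  have hdw : ω - diff k V _ (i + 1) (wedge w A) = ψ - wedge w (ψ.curryLeft (Pi.single w 1)) := by
    have h1 : diff k V _ (i + 1) (wedge w A) =
        (X w : MvPolynomial V k) • A - wedge w (diff k V _ i A) := by
      rw [diff_apply, diff_apply, wedge_sum_smul]
      simp only [curryLeft_wedge, smul_sub, Finset.sum_sub_distrib]
      congr 1
      rw [Finset.sum_eq_single w] <;> simp +contextual [eq_comm]
    rw [h1, hdA, wedge_neg, hψ]
    abel
  refine ⟨wedge w A, fun t ht => ?_⟩
  rw [hdw]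
  by_cases htw : t = w
  · rw [htw]; exact curryLeft_sub_wedge_self w ψ
  · refine curryLeft_sub_wedge_of_ne htw ψ ?_
    rw [hψc, hAc, hT t (Finset.mem_of_mem_insert_of_ne ht htw)]
    ext; simp

/-- The Koszul complex of the variables is exact in positive degrees. -/
theorem cycles_eq_boundaries (i : ℕ) :
    cycles k V (MvPolynomial V k) (i + 1) = boundaries k V (MvPolynomial V k) (i + 1) := by
  refine le_antisymm (fun ω hω => ?_) (boundaries_le_cycles _)
  have key : ∀ T : Finset V, ∃ η, ∀ t ∈ T,
      (ω - diff k V _ (i + 1) η).curryLeft (Pi.single t 1) = 0 := by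
    intro T
    induction T using Finset.induction_on with
    | empty => exact ⟨0, by simp⟩
    | insert w T _ ih =>
      obtain ⟨η, hη⟩ := ih
      obtain ⟨η', hη'⟩ := exists_sub_diff i w T (ω - diff k V _ (i + 1) η)
        (by rw [map_sub, diff_diff, sub_zero]; exact hω) hη
      exact ⟨η + η', by rwa [map_add, ← sub_sub]⟩
  obtain ⟨η, hη⟩ := key Finset.univ
  refine ⟨η, ?_⟩
  have h0 : (ω - diff k V _ (i + 1) η).curryLeft = 0 :=
    LinearMap.pi_ext' fun v => LinearMap.ext_ring (by simpa using hη v (Finset.mem_univ v))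
  refine (sub_eq_zero.mp ?_).symm
  ext1 u
  have := AlternatingMap.curryLeft_apply_apply (ω - diff k V _ (i + 1) η) (u 0) (Fin.tail u)
  rw [h0] at this
  rw [show u = Matrix.vecCons (u 0) (Fin.tail u) from (Fin.cons_self_tail u).symm, ← this]
  rfl

/-- The Koszul complex of the variables has `H_0 = S / (x_v : v ∈ V) = k`. -/
theorem mem_boundaries_zero_iff (ω : Chain k V (MvPolynomial V k) 0) :
    ω ∈ boundaries k V (MvPolynomial V k) 0 ↔
      ω ![] ∈ Ideal.span (Set.range (X : V → MvPolynomial V k)) := by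
  constructor
  · rintro ⟨η, rfl⟩
    rw [diff_apply, sum_apply]
    refine Ideal.sum_mem _ fun v _ => ?_
    exact Ideal.mul_mem_right _ _ (Ideal.subset_span ⟨v, rfl⟩)
  · intro h
    obtain ⟨a, ha⟩ := (Submodule.mem_span_range_iff_exists_fun _).mp h
    refine ⟨∑ v, wedge v (AlternatingMap.constOfIsEmpty k (V → k) (Fin 0) (a v)), ?_⟩
    ext1 u
    rw [Subsingleton.elim u ![], ← ha, map_sum, sum_apply]
    refine Finset.sum_congr rfl fun v _ => ?_
    rw [diff_apply, sum_apply, Finset.sum_eq_single v]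
    · simp [wedge_apply, mul_comm]
    · intro w _ hw
      simp [wedge_apply, hw.symm]
    · simp

end Resolution

end GradedTor

/-! ## Cohen–Macaulay rings -/

/-- A Noetherian local ring is Cohen–Macaulay if its maximal ideal contains a regular sequence whose
length is the Krull dimension of the ring (that is, if depth and dimension agree). -/
def IsCohenMacaulayLocal (R : Type*) [CommRing R] [IsLocalRing R] : Prop :=
  ∃ rs : List R, (∀ r ∈ rs, r ∈ IsLocalRing.maximalIdeal R) ∧
    RingTheory.Sequence.IsRegular R rs ∧ (rs.length : WithBot ℕ∞) = ringKrullDim R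

/-- A ring is Cohen–Macaulay if it is Noetherian and all its localizations at primes are
Cohen–Macaulay local rings. -/
def IsCohenMacaulayRing (R : Type*) [CommRing R] : Prop :=
  IsNoetherianRing R ∧
    ∀ (p : Ideal R) [p.IsPrime], IsCohenMacaulayLocal (Localization.AtPrime p)

/-! ## Simplicial complexes -/

namespace AbstractSimplicialComplex

section Basic

variable {V : Type*} (Δ : AbstractSimplicialComplex V)

/-- The faces of `Δ` including the empty face (Mathlib's `F ∈ Δ` covers the nonempty faces). -/
def IsFace (F : Finset V) : Prop := F = ∅ ∨ F ∈ Δ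

open Classical in
/-- The largest number of vertices of a face, which is `dim Δ + 1`. -/
noncomputable def maxFaceCard [Fintype V] : ℕ :=
  (Finset.univ.filter fun F : Finset V => Δ.IsFace F).sup Finset.card

/-- The dimension of `Δ`; it is `-1` if `∅` is the only face. -/
noncomputable def dim [Fintype V] : ℤ := Δ.maxFaceCard - 1

/-- The codimension `n - d` of `Δ`, where `n` is the number of vertices and `d = dim Δ + 1`. -/
noncomputable def codim [Fintype V] : ℕ := Fintype.card V - Δ.maxFaceCard

variable (k : Type*) [Field k]

/-- The Stanley–Reisner ideal of `Δ`, generated by the squarefree monomials of the nonfaces. -/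
noncomputable def stanleyReisnerIdeal : Ideal (MvPolynomial V k) :=
  Ideal.span {p | ∃ F : Finset V, ¬ Δ.IsFace F ∧ p = ∏ v ∈ F, MvPolynomial.X v}

/-- The Stanley–Reisner ring `k[Δ] = S / I_Δ`. -/
abbrev stanleyReisnerRing : Type _ := MvPolynomial V k ⧸ Δ.stanleyReisnerIdeal k

/-- `Δ` is Cohen–Macaulay over `k`. -/
def IsCohenMacaulay : Prop := IsCohenMacaulayRing (Δ.stanleyReisnerRing k)

/-- The standard grading of `k[Δ]`: the degree `j` part consists of the images of the homogeneous
polynomials of degree `j`, and it is zero for `j < 0`. -/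
noncomputable def stanleyReisnerDegree (j : ℤ) : Submodule k (Δ.stanleyReisnerRing k) :=
  ⨆ (m : ℕ) (_ : (m : ℤ) = j), (MvPolynomial.homogeneousSubmodule V k m).map
    (Ideal.Quotient.mkₐ k (Δ.stanleyReisnerIdeal k)).toLinearMap

variable [Fintype V] [DecidableEq V]

/-- The modified type `dim_k Tor_c^S(S/I_Δ, k) - dim_k Tor_c^S(S/I_Δ, k)_c`, with `c = codim Δ`. -/
noncomputable def modifiedType : ℤ :=
  (Module.finrank k (GradedTor.Tor k V (Δ.stanleyReisnerRing k) Δ.codim) : ℤ) -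
    Module.finrank k
      (GradedTor.torDegree k V (Δ.stanleyReisnerDegree k) Δ.codim (Δ.codim : ℤ))

/-- The type defect. -/
noncomputable def typeDefect : ℤ := Δ.modifiedType k - Δ.codim

end Basic

section Glue

variable {V₁ V₂ : Type*} [DecidableEq V₁] [DecidableEq V₂]

/-- The vertices left after gluing along `E₂ ⊆ V₂`: those of `V₁`, and those of `V₂` off `E₂`. -/
abbrev GlueVertex (V₁ : Type*) {V₂ : Type*} (E₂ : Finset V₂) : Type _ := V₁ ⊕ {v : V₂ // v ∉ E₂}

/-- The map of the vertices of the second complex into those of the glued one: a vertex of `E₂` is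
identified with the corresponding vertex of `E₁`. -/
def glueRight {E₁ : Finset V₁} {E₂ : Finset V₂} (e : E₁ ≃ E₂) (v : V₂) : GlueVertex V₁ E₂ :=
  if h : v ∈ E₂ then Sum.inl (e.symm ⟨v, h⟩ : V₁) else Sum.inr ⟨v, h⟩

/-- The complex obtained from `Δ₁` and `Δ₂`, on disjoint vertex sets, by identifying `E₁` and `E₂`
along the bijection `e`. -/
def glue (Δ₁ : AbstractSimplicialComplex V₁) (Δ₂ : AbstractSimplicialComplex V₂)
    {E₁ : Finset V₁} {E₂ : Finset V₂} (e : E₁ ≃ E₂) :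
    AbstractSimplicialComplex (GlueVertex V₁ E₂) :=
  PreAbstractSimplicialComplex.toAbstractSimplicialComplex _
    (Δ₁.toPreAbstractSimplicialComplex.map Sum.inl ⊔
      Δ₂.toPreAbstractSimplicialComplex.map (glueRight e)) (by
      rintro (v | ⟨v, hv⟩)
      · exact Or.inl ⟨{v}, Δ₁.singleton_mem v, by simp⟩
      · exact Or.inr ⟨{v}, Δ₂.singleton_mem v, by simp [glueRight, hv]⟩)

end Glue

end AbstractSimplicialComplex

/-! Let `V` be the glued vertex set, `S = k[x_v : v ∈ V]`, and let `P`, `Q` be the faces of `Δ₁`,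
`Δ₂` regarded as families of subsets of `V`. Their union is the glued complex and their intersection
is the full simplex on the common face `E`. For monomial ideals this gives `I_P ∩ I_Q = I_Δ` and
`I_P + I_Q = I_E`, so that `k[Δ]` is the fibre product of `S/I_P` and `S/I_Q` over `k[E] = S/I_E`,
and there is a long exact sequence `Tor_{c+1}(S/I_P) ⊕ Tor_{c+1}(S/I_Q) → Tor_{c+1}(k[E]) →
Tor_c(k[Δ]) → Tor_c(S/I_P) ⊕ Tor_c(S/I_Q) → Tor_c(k[E])`. Three facts turn it into the formula.
Cohen–Macaulayness kills the leftmost term, by depth sensitivity of the Koszul complex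
(`cycles_le_boundaries_of_isWeaklyRegular`, `IsCohenMacaulay.cyclesIn_le`). The homology of `k[E]`
is the exterior algebra on the variables outside `E`, so `Tor_{c+1}(k[E])` has dimension `binom(n -
ℓ, c + 1)` (`relDim_simplex`). Finally, `Tor_c(k[E])` lives in degree `c`, the degree which the
modified type discards. Discarding degree `c` is expressed by admitting only the cycles with values
in the irrelevant ideal (`modifiedType_eq_relDim`). Such cycles of `k[E]` are boundaries
(`cyclesIn_simplex_le`), so the last map vanishes on them. This form of the modified type also
survives the passage from the vertices of `Δ₁` or `Δ₂` to `V`: every new variable acts as zero and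
only shifts the top homology by one (`relDim_vertices`). The exact sequence itself is
`relDim_pullback`, applied in `relDim_faceIdeal_sup`. -/

/-! ### Dimensions of subquotients. -/

section RelDim

variable {k : Type*} [Field k] {C C' : Type*} [AddCommGroup C] [Module k C]
  [AddCommGroup C'] [Module k C']

/-- The dimension of `Z / (B ∩ Z)`. -/
noncomputable def relDim (B Z : Submodule k C) : ℕ := Module.finrank k (Z ⧸ B.submoduleOf Z)

theorem relDim_eq_finrank_of_surjective {D : Type*} [AddCommGroup D] [Module k D]
    {B Z : Submodule k C} (f : Z →ₗ[k] D) (hf : Function.Surjective f)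
    (hker : ∀ z : Z, f z = 0 ↔ (z : C) ∈ B) : relDim B Z = Module.finrank k D := by
  have h : LinearMap.ker f = B.submoduleOf Z := by
    ext z; exact (LinearMap.mem_ker.trans (hker z))
  rw [relDim, ← h]
  exact (f.quotKerEquivOfSurjective hf).finrank_eq

/-- The map need only be onto modulo `B'`, so homology groups can be compared without an isomorphism
of chains. -/
theorem relDim_eq_of_map {B Z : Submodule k C} {B' Z' : Submodule k C'} (f : C →ₗ[k] C')
    (h₁ : ∀ z ∈ Z, f z ∈ Z') (h₂ : ∀ z' ∈ Z', ∃ z ∈ Z, z' - f z ∈ B')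
    (h₃ : ∀ z ∈ Z, f z ∈ B' ↔ z ∈ B) : relDim B Z = relDim B' Z' := by
  refine relDim_eq_finrank_of_surjective
    ((B'.submoduleOf Z').mkQ ∘ₗ f.restrict h₁) ?_ ?_
  · intro q
    obtain ⟨z', rfl⟩ := Submodule.mkQ_surjective _ q
    obtain ⟨z, hz, hzz⟩ := h₂ z' z'.2
    refine ⟨⟨z, hz⟩, ?_⟩
    rw [LinearMap.comp_apply, eq_comm, ← sub_eq_zero, ← map_sub, Submodule.mkQ_apply,
      Submodule.Quotient.mk_eq_zero]
    exact hzz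
  · intro z
    rw [← h₃ z z.2, LinearMap.comp_apply, Submodule.mkQ_apply, Submodule.Quotient.mk_eq_zero]
    rfl

/-- Rank-nullity for `Z/B → Z/B'`, whose kernel is `B'/B`. Finiteness matters because `finrank` is
`0` on infinite-dimensional spaces. -/
theorem relDim_add {B B' Z : Submodule k C} (h₁ : B ≤ B') (h₂ : B' ≤ Z)
    [Module.Finite k (Z ⧸ B.submoduleOf Z)] : relDim B Z = relDim B B' + relDim B' Z := by
  have hle : B.submoduleOf Z ≤ B'.submoduleOf Z := fun z hz => h₁ hz
  set φ : (Z ⧸ B.submoduleOf Z) →ₗ[k] (Z ⧸ B'.submoduleOf Z) := Submodule.factor hle with hφ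
  have hsurj : Function.Surjective φ := Submodule.factor_surjective hle
  have h := LinearMap.finrank_range_add_finrank_ker φ
  rw [LinearMap.range_eq_top.2 hsurj, finrank_top] at h
  have hk : relDim B B' = Module.finrank k (LinearMap.ker φ) := by
    refine relDim_eq_finrank_of_surjective
      (((B.submoduleOf Z).mkQ ∘ₗ Submodule.inclusion h₂).codRestrict (LinearMap.ker φ) ?_) ?_ ?_
    · intro b
      rw [LinearMap.mem_ker, LinearMap.comp_apply, hφ, Submodule.factor_mk,
        Submodule.mkQ_apply, Submodule.Quotient.mk_eq_zero]
      exact b.2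
    · rintro ⟨q, hq⟩
      obtain ⟨z, rfl⟩ := Submodule.mkQ_surjective _ q
      have hz := hq
      rw [LinearMap.mem_ker, hφ, Submodule.factor_mk, Submodule.mkQ_apply,
        Submodule.Quotient.mk_eq_zero] at hz
      exact ⟨⟨z, hz⟩, rfl⟩
    · intro b
      rw [← Subtype.coe_inj, LinearMap.codRestrict_apply, LinearMap.comp_apply,
        Submodule.mkQ_apply, Submodule.coe_zero, Submodule.Quotient.mk_eq_zero]
      rfl
  rw [hk, relDim, relDim, ← h, add_comm]

/-- Composing with such a section lifts alternating maps along linear maps; it is what makes the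
chain functor exact. -/
theorem LinearMap.exists_section_on_range (f : C →ₗ[k] C') :
    ∃ g : C' →ₗ[k] C, ∀ y ∈ LinearMap.range f, f (g y) = y := by
  obtain ⟨s, hs⟩ := f.rangeRestrict.exists_rightInverse_of_surjective f.range_rangeRestrict
  obtain ⟨g, hg⟩ := LinearMap.exists_extend s
  refine ⟨g, fun y hy => ?_⟩
  have h1 : g y = s ⟨y, hy⟩ := by rw [← hg]; rfl
  rw [h1]
  exact congrArg Subtype.val (LinearMap.congr_fun hs ⟨y, hy⟩)

end RelDim

/-! ### Contractions and homotopies in the Koszul complex. -/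

namespace GradedTor

set_option linter.unusedSectionVars false

open MvPolynomial

theorem apply_eq_zero_of_curryLeft {k E U : Type*} [CommRing k] [AddCommGroup E]
    [Module k E] [AddCommGroup U] [Module k U] {i : ℕ} {ψ : E [⋀^Fin (i + 1)]→ₗ[k] U} {x : E}
    (h : ψ.curryLeft x = 0) {u : Fin (i + 1) → E} {j : Fin (i + 1)} (hu : u j = x) :
    ψ u = 0 := by
  have h1 : ∀ u : Fin (i + 1) → E, u 0 = x → ψ u = 0 := by
    intro u hu
    have := congrArg (fun η => η (Fin.tail u)) h
    rw [AlternatingMap.curryLeft_apply_apply, ← hu] at this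
    rw [← Fin.cons_self_tail u]
    exact this
  by_cases hj : j = 0
  · exact h1 u (hj ▸ hu)
  · have := ψ.map_swap u (Ne.symm hj)
    rw [h1 _ (by simp [hu])] at this
    exact neg_eq_zero.1 this.symm

section Homotopy

variable {k : Type*} [Field k] {V : Type*} [Fintype V] [DecidableEq V]
  {M : Type*} [AddCommGroup M] [Module (MvPolynomial V k) M]
  [Module k M] [IsScalarTower k (MvPolynomial V k) M]
  {M' : Type*} [AddCommGroup M'] [Module (MvPolynomial V k) M']
  [Module k M'] [IsScalarTower k (MvPolynomial V k) M']

theorem diff_apply_apply (i : ℕ) (ω : Chain k V M (i + 1)) (u : Fin i → V → k) :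
    diff k V M i ω u = ∑ v : V, (X v : MvPolynomial V k) • ω (Matrix.vecCons (Pi.single v 1) u) := by
  rw [diff_apply, sum_apply]
  rfl

theorem diff_wedge_zero (w : V) (ω : Chain k V M 0) :
    diff k V M 0 (wedge w ω) = (X w : MvPolynomial V k) • ω := by
  rw [diff_apply, Finset.sum_eq_single w]
  · rw [curryLeft_wedge_zero]; simp
  · intro v _ hv
    rw [curryLeft_wedge_zero]; simp [hv.symm]
  · simp

theorem diff_wedge (w : V) {i : ℕ} (ω : Chain k V M (i + 1)) :
    diff k V M (i + 1) (wedge w ω) =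
      (X w : MvPolynomial V k) • ω - wedge w (diff k V M i ω) := by
  rw [diff_apply, diff_apply, wedge_sum_smul]
  simp only [curryLeft_wedge, smul_sub, Finset.sum_sub_distrib]
  congr 1
  rw [Finset.sum_eq_single w] <;> simp +contextual [eq_comm]

theorem curryLeft_anticomm {i : ℕ} (ω : Chain k V M (i + 2)) (x y : V → k) :
    (ω.curryLeft x).curryLeft y = -(ω.curryLeft y).curryLeft x := by
  have h := AlternatingMap.curryLeft_same ω (x + y)
  simp only [map_add, AlternatingMap.curryLeft_add, LinearMap.add_apply,
    AlternatingMap.curryLeft_same, zero_add, add_zero] at h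
  first
  | exact eq_neg_of_add_eq_zero_left h
  | exact eq_neg_of_add_eq_zero_right h

/-- Contraction by `x` and the differential, itself a sum of contractions, anticommute. Hence
contractions preserve cycles and boundaries. -/
theorem curryLeft_diff {i : ℕ} (ω : Chain k V M (i + 2)) (x : V → k) :
    (diff k V M (i + 1) ω).curryLeft x = -diff k V M i (ω.curryLeft x) := by
  ext u
  rw [AlternatingMap.curryLeft_apply_apply, AlternatingMap.neg_apply, diff_apply_apply,
    diff_apply_apply, ← Finset.sum_neg_distrib]
  refine Finset.sum_congr rfl fun v _ => ?_
  rw [← smul_neg]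
  congr 1
  have := congrArg (fun η => η u) (curryLeft_anticomm ω (Pi.single v 1) x)
  simpa using this

theorem curryLeft_mem_cycles {i : ℕ} {ω : Chain k V M (i + 1)} (h : ω ∈ cycles k V M (i + 1))
    (x : V → k) : ω.curryLeft x ∈ cycles k V M i := by
  cases i with
  | zero => trivial
  | succ i =>
    change diff k V M i _ = 0
    have h' : diff k V M (i + 1) ω = 0 := h
    have := curryLeft_diff ω x
    rw [h'] at this
    rw [← neg_eq_zero, ← this]; ext; simp

theorem diff_compAlternatingMap (f : M →ₗ[k] M')
    (hf : ∀ (v : V) m, f ((X v : MvPolynomial V k) • m) = (X v : MvPolynomial V k) • f m)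
    (i : ℕ) (ω : Chain k V M (i + 1)) :
    diff k V M' i (f.compAlternatingMap ω) = f.compAlternatingMap (diff k V M i ω) := by
  ext u
  rw [diff_apply_apply, LinearMap.compAlternatingMap_apply, diff_apply_apply, map_sum]
  simp [hf]

theorem compAlternatingMap_mem_cycles (f : M →ₗ[k] M')
    (hf : ∀ (v : V) m, f ((X v : MvPolynomial V k) • m) = (X v : MvPolynomial V k) • f m)
    {i : ℕ} {ω : Chain k V M i} (h : ω ∈ cycles k V M i) :
    f.compAlternatingMap ω ∈ cycles k V M' i := by
  cases i with
  | zero => trivial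
  | succ i =>
    have h' : diff k V M i ω = 0 := h
    change diff k V M' i _ = 0
    rw [diff_compAlternatingMap f hf, h', LinearMap.compAlternatingMap_zero]

/-- Variables act as zero on Koszul homology. -/
theorem X_smul_mem_boundaries {i : ℕ} {ω : Chain k V M i} (h : ω ∈ cycles k V M i) (w : V) :
    (X w : MvPolynomial V k) • ω ∈ boundaries k V M i := by
  refine ⟨wedge w ω, ?_⟩
  cases i with
  | zero => exact diff_wedge_zero w ω
  | succ i =>
    have h' : diff k V M i ω = 0 := h
    rw [diff_wedge, h', wedge_zero, sub_zero]

end Homotopy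

/-! ### Koszul complexes on part of the variables, and variables that act as zero. -/

section Supported

variable {k : Type*} [Field k] {V : Type*} [Fintype V] [DecidableEq V]
  {M : Type*} [AddCommGroup M] [Module (MvPolynomial V k) M]
  [Module k M] [IsScalarTower k (MvPolynomial V k) M]

variable (k V M) in
/-- The chains that only involve the variables `x_v` with `v ∈ T`. -/
def supportedOn (T : Finset V) (i : ℕ) : Submodule k (Chain k V M i) where
  carrier := {ω | ∀ u : Fin i → V → k, (∃ j, ∃ v ∉ T, u j = Pi.single v 1) → ω u = 0}
  add_mem' h h' u hu := by rw [AlternatingMap.add_apply, h u hu, h' u hu, add_zero]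
  zero_mem' _ _ := rfl
  smul_mem' a _ h u hu := by rw [AlternatingMap.smul_apply, h u hu, smul_zero]

/-- The chains with values in `N`. -/
def valuesIn (N : Submodule k M) (i : ℕ) : Submodule k (Chain k V M i) where
  carrier := {ω | ∀ u, ω u ∈ N}
  add_mem' h h' u := N.add_mem (h u) (h' u)
  zero_mem' _ := N.zero_mem
  smul_mem' a _ h u := N.smul_mem a (h u)

/-- The cycles with values in `N` in the Koszul complex of the variables `x_v`, `v ∈ T`. -/
noncomputable def cyclesIn (T : Finset V) (N : Submodule k M) (i : ℕ) :
    Submodule k (Chain k V M i) :=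
  supportedOn k V M T i ⊓ (cycles k V M i).restrictScalars k ⊓ valuesIn N i

variable (k M) in
/-- The boundaries in the Koszul complex of the variables `x_v`, `v ∈ T`. -/
noncomputable def boundariesIn (T : Finset V) (i : ℕ) : Submodule k (Chain k V M i) :=
  (supportedOn k V M T (i + 1)).map ((diff k V M i).restrictScalars k)

theorem mem_supportedOn_succ {T : Finset V} {i : ℕ} {ω : Chain k V M (i + 1)} :
    ω ∈ supportedOn k V M T (i + 1) ↔ ∀ v ∉ T, ω.curryLeft (Pi.single v 1) = 0 := by
  constructor
  · intro h v hv
    ext u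
    exact h _ ⟨0, v, hv, rfl⟩
  · rintro h u ⟨j, v, hv, hu⟩
    exact apply_eq_zero_of_curryLeft (h v hv) hu

theorem mem_supportedOn_zero (T : Finset V) (ω : Chain k V M 0) :
    ω ∈ supportedOn k V M T 0 := by
  rintro u ⟨j, -⟩
  exact j.elim0

theorem mem_supportedOn_univ {i : ℕ} (ω : Chain k V M i) :
    ω ∈ supportedOn k V M Finset.univ i := by
  rintro u ⟨j, v, hv, -⟩
  exact absurd (Finset.mem_univ v) hv

theorem supportedOn_mono {T T' : Finset V} (h : T ⊆ T') (i : ℕ) :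
    supportedOn k V M T i ≤ supportedOn k V M T' i :=
  fun _ hω u ⟨j, v, hv, hu⟩ => hω u ⟨j, v, fun hv' => hv (h hv'), hu⟩

theorem boundariesIn_mono {T T' : Finset V} (h : T ⊆ T') (i : ℕ) :
    boundariesIn k M T i ≤ boundariesIn k M T' i :=
  Submodule.map_mono (supportedOn_mono h _)

theorem boundariesIn_univ (i : ℕ) :
    boundariesIn k M (Finset.univ : Finset V) i = (boundaries k V M i).restrictScalars k := by
  ext ω
  exact ⟨fun ⟨η, _, h⟩ => ⟨η, h⟩, fun ⟨η, h⟩ => ⟨η, mem_supportedOn_univ η, h⟩⟩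

theorem mem_cyclesIn {T : Finset V} {N : Submodule k M} {i : ℕ} {ω : Chain k V M i} :
    ω ∈ cyclesIn T N i ↔
      ω ∈ supportedOn k V M T i ∧ ω ∈ cycles k V M i ∧ ∀ u, ω u ∈ N := and_assoc

theorem wedge_mem_supportedOn {T : Finset V} (w : V) {i : ℕ} {ω : Chain k V M i}
    (h : ω ∈ supportedOn k V M T i) :
    wedge w ω ∈ supportedOn k V M (insert w T) (i + 1) := by
  rw [mem_supportedOn_succ]
  intro v hv
  rw [Finset.mem_insert, not_or] at hv
  cases i with
  | zero => rw [curryLeft_wedge_zero, Pi.single_eq_of_ne (Ne.symm hv.1), zero_smul]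
  | succ i =>
    rw [curryLeft_wedge, Pi.single_eq_of_ne (Ne.symm hv.1), zero_smul, zero_sub,
      mem_supportedOn_succ.1 h v hv.2, wedge_zero, neg_zero]

theorem curryLeft_mem_supportedOn {T : Finset V} (w : V) {i : ℕ} {ω : Chain k V M (i + 1)}
    (h : ω ∈ supportedOn k V M (insert w T) (i + 1)) :
    ω.curryLeft (Pi.single w 1) ∈ supportedOn k V M T i := by
  cases i with
  | zero => exact mem_supportedOn_zero _ _
  | succ i =>
    rw [mem_supportedOn_succ] at h ⊢
    intro v hv
    by_cases hvw : v = w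
    · rw [hvw, AlternatingMap.curryLeft_same]
    · exact curryLeft_curryLeft_of_eq_zero _ _ _ (h v (by simp [hvw, hv]))

/-- With `wedge_mem_supportedOn` and `curryLeft_mem_supportedOn` this is the splitting `K(T ∪ {w}) =
K(T) ⊕ e_w^* ∧ K(T)`: the second component is read off by contraction with `e_w`. -/
theorem sub_wedge_mem_supportedOn {T : Finset V} (w : V) {i : ℕ} {ω : Chain k V M (i + 1)}
    (h : ω ∈ supportedOn k V M (insert w T) (i + 1)) :
    ω - wedge w (ω.curryLeft (Pi.single w 1)) ∈ supportedOn k V M T (i + 1) := by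
  rw [mem_supportedOn_succ] at h ⊢
  intro v hv
  by_cases hvw : v = w
  · rw [hvw]; exact curryLeft_sub_wedge_self w ω
  · exact curryLeft_sub_wedge_of_ne hvw ω (h v (by simp [hvw, hv]))

theorem wedge_apply_mem {N : Submodule k M} (w : V) {i : ℕ} {ω : Chain k V M i}
    (h : ∀ u, ω u ∈ N) (u : Fin (i + 1) → V → k) : wedge w ω u ∈ N := by
  rw [wedge_apply]
  refine N.sum_mem fun j _ => ?_
  have := N.smul_mem (u j w) (h (j.removeNth u))
  rcases neg_one_pow_eq_or ℤ (j : ℕ) with h1 | h1 <;> rw [h1]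
  · rwa [one_smul]
  · rw [neg_one_smul]; exact N.neg_mem this

theorem wedge_mem_cycles {w : V} (hw : ∀ m : M, (X w : MvPolynomial V k) • m = 0) {i : ℕ}
    {ω : Chain k V M i} (h : ω ∈ cycles k V M i) : wedge w ω ∈ cycles k V M (i + 1) := by
  change diff k V M i _ = 0
  have h0 : (X w : MvPolynomial V k) • ω = 0 := by ext u; simp [hw]
  cases i with
  | zero => rw [diff_wedge_zero, h0]
  | succ i => rw [diff_wedge, h0, show diff k V M i ω = 0 from h, wedge_zero, sub_zero]

/-- Split `ω` into a part free of `w` and `e_w^* ∧ ι_w ω`. Both are cycles because `x_w` acts as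
zero. The first bounds by `hT`; if `ι_w ω = dη`, the second is `d(-e_w^* ∧ η)`. -/
theorem mem_boundariesIn_insert {T : Finset V} {N : Submodule k M} {w : V}
    (hw : ∀ m : M, (X w : MvPolynomial V k) • m = 0) {i : ℕ}
    (hT : cyclesIn T N (i + 1) ≤ boundariesIn k M T (i + 1)) {ω : Chain k V M (i + 1)}
    (hω : ω ∈ cyclesIn (insert w T) N (i + 1))
    (hc : ω.curryLeft (Pi.single w 1) ∈ boundariesIn k M T i) :
    ω ∈ boundariesIn k M (insert w T) (i + 1) := by
  obtain ⟨h1, h2, h3⟩ := mem_cyclesIn.1 hω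
  have h4 : ω - wedge w (ω.curryLeft (Pi.single w 1)) ∈ boundariesIn k M T (i + 1) := by
    refine hT (mem_cyclesIn.2 ⟨sub_wedge_mem_supportedOn w h1, ?_, fun u => ?_⟩)
    · exact Submodule.sub_mem _ h2 (wedge_mem_cycles hw (curryLeft_mem_cycles h2 _))
    · exact N.sub_mem (h3 u) 
        (wedge_apply_mem (ω := ω.curryLeft (Pi.single w 1)) w (fun _ => h3 _) u)
  obtain ⟨η, hη, hη'⟩ := hc
  have hη' : diff k V M i η = ω.curryLeft (Pi.single w 1) := hη'
  have h5 : wedge w (ω.curryLeft (Pi.single w 1)) ∈ boundariesIn k M (insert w T) (i + 1) := by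
    refine ⟨-wedge w η, Submodule.neg_mem _ (wedge_mem_supportedOn w hη), ?_⟩
    change diff k V M (i + 1) _ = _
    have h0 : (X w : MvPolynomial V k) • η = 0 := by ext u; simp [hw]
    rw [map_neg, diff_wedge, h0, zero_sub, neg_neg, hη']
  have := Submodule.add_mem _ (boundariesIn_mono (Finset.subset_insert w T) _ h4) h5
  rwa [sub_add_cancel] at this

theorem curryLeft_mem_cyclesIn {T : Finset V} {N : Submodule k M} (w : V) {i : ℕ}
    {ω : Chain k V M (i + 1)} (hω : ω ∈ cyclesIn (insert w T) N (i + 1)) :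
    ω.curryLeft (Pi.single w 1) ∈ cyclesIn T N i := by
  obtain ⟨h1, h2, h3⟩ := mem_cyclesIn.1 hω
  exact mem_cyclesIn.2 ⟨curryLeft_mem_supportedOn w h1, curryLeft_mem_cycles h2 _, fun u => h3 _⟩

theorem cyclesIn_insert_le {T : Finset V} {N : Submodule k M} {w : V}
    (hw : ∀ m : M, (X w : MvPolynomial V k) • m = 0) {i : ℕ}
    (h₀ : cyclesIn T N i ≤ boundariesIn k M T i)
    (h₁ : cyclesIn T N (i + 1) ≤ boundariesIn k M T (i + 1)) :
    cyclesIn (insert w T) N (i + 1) ≤ boundariesIn k M (insert w T) (i + 1) :=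
  fun _ hω => mem_boundariesIn_insert hw h₁ hω (h₀ (curryLeft_mem_cyclesIn w hω))

/-- Each variable acting as zero raises the bound for vanishing homology by at most one. -/
theorem cyclesIn_union_le {T U : Finset V} {N : Submodule k M}
    (hU : ∀ w ∈ U, ∀ m : M, (X w : MvPolynomial V k) • m = 0) (a : ℕ)
    (h : ∀ i, a ≤ i → cyclesIn T N i ≤ boundariesIn k M T i) (i : ℕ) (hi : a + U.card ≤ i) :
    cyclesIn (U ∪ T) N i ≤ boundariesIn k M (U ∪ T) i := by
  induction U using Finset.induction_on generalizing i with
  | empty => rw [Finset.empty_union]; exact h i (by simpa using hi)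
  | insert w U hwU ih =>
    rw [Finset.card_insert_of_notMem hwU] at hi
    have ih' := ih fun w hw => hU w (Finset.mem_insert_of_mem hw)
    obtain ⟨j, rfl⟩ : ∃ j, i = j + 1 := ⟨i - 1, by omega⟩
    rw [Finset.insert_union]
    exact cyclesIn_insert_le (hU w (Finset.mem_insert_self _ _)) (ih' j (by omega))
      (ih' (j + 1) (by omega))

/-- If the `N`-valued homology vanishes in all degrees, there is nothing to shift and no bound is
lost. -/
theorem cyclesIn_union_le_of_forall {T U : Finset V} {N : Submodule k M}
    (hU : ∀ w ∈ U, ∀ m : M, (X w : MvPolynomial V k) • m = 0)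
    (h : ∀ i, cyclesIn T N i ≤ boundariesIn k M T i) (i : ℕ) :
    cyclesIn (U ∪ T) N i ≤ boundariesIn k M (U ∪ T) i := by
  induction U using Finset.induction_on generalizing i with
  | empty => rw [Finset.empty_union]; exact h i
  | insert w U hwU ih =>
    have ih' := ih fun w hw => hU w (Finset.mem_insert_of_mem hw)
    rw [Finset.insert_union]
    cases i with
    | zero =>
      intro ω hω
      obtain ⟨-, h2, h3⟩ := mem_cyclesIn.1 hω
      exact boundariesIn_mono (Finset.subset_insert _ _) _
        (ih' 0 (mem_cyclesIn.2 ⟨mem_supportedOn_zero _ _, h2, h3⟩))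
    | succ i =>
      exact cyclesIn_insert_le (hU w (Finset.mem_insert_self _ _)) (ih' i) (ih' (i + 1))

/-- The homology for `T ∪ {w}` is `H_{i+1}(T) ⊕ e_w^* ∧ H_i(T)`. The first summand vanishes by `h`,
so contraction with `e_w` is an isomorphism, with inverse the product with `e_w^*`. -/
theorem relDim_cyclesIn_insert {T : Finset V} {N : Submodule k M} {w : V} (hwT : w ∉ T)
    (hw : ∀ m : M, (X w : MvPolynomial V k) • m = 0) {i : ℕ}
    (h : cyclesIn T N (i + 1) ≤ boundariesIn k M T (i + 1)) :
    relDim (boundariesIn k M (insert w T) (i + 1)) (cyclesIn (insert w T) N (i + 1)) =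
      relDim (boundariesIn k M T i) (cyclesIn T N i) := by
  let f : Chain k V M (i + 1) →ₗ[k] Chain k V M i :=
    { toFun := fun ω => ω.curryLeft (Pi.single w 1)
      map_add' := fun _ _ => rfl
      map_smul' := fun _ _ => rfl }
  refine relDim_eq_of_map f (fun ω hω => curryLeft_mem_cyclesIn w hω) ?_ ?_
  · intro ω hω
    obtain ⟨h1, h2, h3⟩ := mem_cyclesIn.1 hω
    refine ⟨wedge w ω, mem_cyclesIn.2 ⟨wedge_mem_supportedOn w h1, wedge_mem_cycles hw h2,
      wedge_apply_mem w h3⟩, ?_⟩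
    have : (wedge w ω).curryLeft (Pi.single w 1) = ω := by
      cases i with
      | zero => rw [curryLeft_wedge_zero]; simp
      | succ i => rw [curryLeft_wedge, mem_supportedOn_succ.1 h1 w hwT, wedge_zero]; simp
    change ω - (wedge w ω).curryLeft (Pi.single w 1) ∈ _
    rw [this, sub_self]
    exact Submodule.zero_mem _
  · intro ω hω
    refine ⟨mem_boundariesIn_insert hw h hω, ?_⟩
    rintro ⟨η, hη, rfl⟩
    refine ⟨-η.curryLeft (Pi.single w 1),
      Submodule.neg_mem _ (curryLeft_mem_supportedOn w hη), ?_⟩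
    change diff k V M i _ = (diff k V M (i + 1) η).curryLeft _
    rw [map_neg, curryLeft_diff]

theorem relDim_cyclesIn_union {T U : Finset V} (hTU : Disjoint U T) {N : Submodule k M}
    (hU : ∀ w ∈ U, ∀ m : M, (X w : MvPolynomial V k) • m = 0) (c : ℕ)
    (h : ∀ i, c + 1 ≤ i → cyclesIn T N i ≤ boundariesIn k M T i) :
    relDim (boundariesIn k M (U ∪ T) (c + U.card)) (cyclesIn (U ∪ T) N (c + U.card)) =
      relDim (boundariesIn k M T c) (cyclesIn T N c) := by
  induction U using Finset.induction_on with
  | empty => rw [Finset.empty_union, Finset.card_empty, add_zero]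
  | insert w U hwU ih =>
    rw [Finset.disjoint_insert_left] at hTU
    have hU' := fun w hw => hU w (Finset.mem_insert_of_mem hw)
    rw [Finset.card_insert_of_notMem hwU, Finset.insert_union, ← add_assoc, ← ih hTU.2 hU']
    refine relDim_cyclesIn_insert (by simp [hwU, hTU.1]) (hU w (Finset.mem_insert_self _ _)) ?_
    exact cyclesIn_union_le hU' (c + 1) h _ (by omega)

end Supported

/-! ### Relabelling the variables along an injection. -/

section ChangeOfVariables

variable {k : Type*} [Field k] {W V : Type*} [Fintype W] [DecidableEq W]
  [Fintype V] [DecidableEq V]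
  {L : Type*} [AddCommGroup L] [Module (MvPolynomial W k) L]
  [Module k L] [IsScalarTower k (MvPolynomial W k) L]
  {M : Type*} [AddCommGroup M] [Module (MvPolynomial V k) M]
  [Module k M] [IsScalarTower k (MvPolynomial V k) M]

/-- The map from the chains over `k[x_w : w ∈ W]` to those over `k[x_v : v ∈ V]` that is induced by
a map `W → V` of variables. -/
def transferChain (φ : W → V) (θ : L ≃ₗ[k] M) (i : ℕ) : Chain k W L i →ₗ[k] Chain k V M i where
  toFun ω := (θ.toLinearMap.compAlternatingMap ω).compLinearMap (LinearMap.funLeft k k φ)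
  map_add' ω η := by ext u; simp
  map_smul' a ω := by ext u; simp

theorem transferChain_apply (φ : W → V) (θ : L ≃ₗ[k] M) (i : ℕ) (ω : Chain k W L i)
    (u : Fin i → V → k) : transferChain φ θ i ω u = θ (ω fun j => u j ∘ φ) := rfl

theorem single_comp_of_notMem {φ : W → V} {v : V} (hv : v ∉ Set.range φ) :
    (Pi.single v (1 : k) : V → k) ∘ φ = 0 := by
  ext w
  exact Pi.single_eq_of_ne (fun h => hv ⟨w, h⟩) _

theorem single_comp_apply {φ : W → V} (hφ : Function.Injective φ) (w : W) :
    (Pi.single (φ w) (1 : k) : V → k) ∘ φ = Pi.single w 1 := by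
  ext w'
  simp [Pi.single_apply, hφ.eq_iff]

theorem vecCons_comp (φ : W → V) {i : ℕ} (x : V → k) (u : Fin i → V → k) :
    (fun j => (Matrix.vecCons x u : Fin (i + 1) → V → k) j ∘ φ) =
      Matrix.vecCons (x ∘ φ) (fun j => u j ∘ φ) := by
  funext j
  refine Fin.cases rfl (fun j => rfl) j

theorem diff_transferChain {φ : W → V} (hφ : Function.Injective φ) (θ : L ≃ₗ[k] M)
    (hθ : ∀ (w : W) m, θ ((X w : MvPolynomial W k) • m) = (X (φ w) : MvPolynomial V k) • θ m)
    (i : ℕ) (ω : Chain k W L (i + 1)) :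
    diff k V M i (transferChain φ θ (i + 1) ω) = transferChain φ θ i (diff k W L i ω) := by
  ext u
  rw [diff_apply_apply, transferChain_apply, diff_apply_apply, map_sum]
  symm
  refine Fintype.sum_of_injective φ hφ _ _ (fun v hv => ?_) (fun w => ?_)
  -- A basis vector outside the image of `φ` restricts to zero, so its summand in the differential
  -- disappears.
  · rw [transferChain_apply, vecCons_comp, single_comp_of_notMem hv,
      AlternatingMap.map_coord_zero ω (0 : Fin (i + 1)) rfl, map_zero, smul_zero]
  · rw [transferChain_apply, vecCons_comp, single_comp_apply hφ, hθ]

theorem transferChain_mem_supportedOn (φ : W → V) (θ : L ≃ₗ[k] M) (i : ℕ) (ω : Chain k W L i) :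
    transferChain φ θ i ω ∈ supportedOn k V M (Finset.univ.image φ) i := by
  rintro u ⟨j, v, hv, hu⟩
  have hv' : v ∉ Set.range φ := by simpa using hv
  rw [transferChain_apply, ω.map_coord_zero j, map_zero]
  rw [hu, single_comp_of_notMem hv']

theorem transferChain_injective {φ : W → V} (hφ : Function.Injective φ) (θ : L ≃ₗ[k] M) (i : ℕ) :
    Function.Injective (transferChain φ θ i) := by
  rw [injective_iff_map_eq_zero]
  intro ω h
  refine Module.Basis.ext_alternating (Pi.basisFun k W) fun v _ => ?_
  have := congrArg (fun η => η fun j => Pi.single (φ (v j)) 1) h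
  simp only [transferChain_apply, single_comp_apply hφ, AlternatingMap.zero_apply,
    LinearEquiv.map_eq_zero_iff] at this
  simpa using this

theorem exists_transferChain_eq {φ : W → V} (hφ : Function.Injective φ) (θ : L ≃ₗ[k] M) {i : ℕ}
    {ψ : Chain k V M i} (hψ : ψ ∈ supportedOn k V M (Finset.univ.image φ) i) :
    ∃ ω, transferChain φ θ i ω = ψ := by
  -- The preimage evaluates `ψ` on vectors extended by zero. It is enough to compare on basis
  -- vectors: if one lies outside the image of `φ`, both sides vanish, since `ψ` involves only
  -- variables from the image.
  refine ⟨(θ.symm.toLinearMap.compAlternatingMap ψ).compLinearMap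
    (Function.ExtendByZero.linearMap k φ), ?_⟩
  refine Module.Basis.ext_alternating (Pi.basisFun k V) fun v _ => ?_
  simp only [transferChain_apply, AlternatingMap.compLinearMap_apply, Pi.basisFun_apply,
    LinearMap.compAlternatingMap_apply, LinearEquiv.coe_coe, LinearEquiv.apply_symm_apply]
  by_cases h : ∀ j, v j ∈ Set.range φ
  · congr 1
    funext j
    obtain ⟨w, hw⟩ := h j
    rw [← hw, single_comp_apply hφ]
    ext v'
    by_cases hv' : v' ∈ Set.range φ
    · obtain ⟨w', rfl⟩ := hv'
      rw [Function.ExtendByZero.linearMap_apply, hφ.extend_apply]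
      simp [Pi.single_apply, hφ.eq_iff]
    · rw [Function.ExtendByZero.linearMap_apply, Function.extend_apply' _ _ _ (by simpa using hv'),
        Pi.single_eq_of_ne (fun h => hv' ⟨w, h.symm⟩)]
      rfl
  · push Not at h
    obtain ⟨j, hj⟩ := h
    rw [ψ.map_coord_zero j (by rw [single_comp_of_notMem hj, map_zero])]
    exact (hψ _ ⟨j, v j, by simpa using hj, rfl⟩).symm

section Transfer

variable {φ : W → V} (hφ : Function.Injective φ) (θ : L ≃ₗ[k] M)
  (hθ : ∀ (w : W) m, θ ((X w : MvPolynomial W k) • m) = (X (φ w) : MvPolynomial V k) • θ m)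

include hφ hθ

theorem transferChain_mem_cycles_iff {i : ℕ} {ω : Chain k W L i} :
    transferChain φ θ i ω ∈ cycles k V M i ↔ ω ∈ cycles k W L i := by
  cases i with
  | zero => exact Iff.rfl
  | succ i =>
    change diff k V M i _ = 0 ↔ diff k W L i ω = 0
    rw [diff_transferChain hφ θ hθ, map_eq_zero_iff _ (transferChain_injective hφ θ i)]

theorem transferChain_mem_boundariesIn_iff {i : ℕ} {ω : Chain k W L i} :
    transferChain φ θ i ω ∈ boundariesIn k M (Finset.univ.image φ) i ↔
      ω ∈ boundariesIn k L Finset.univ i := by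
  constructor
  · rintro ⟨ψ, hψ, h⟩
    obtain ⟨η, rfl⟩ := exists_transferChain_eq hφ θ hψ
    refine ⟨η, mem_supportedOn_univ η, transferChain_injective hφ θ i ?_⟩
    rw [← h]
    exact (diff_transferChain hφ θ hθ i η).symm
  · rintro ⟨η, -, rfl⟩
    exact ⟨transferChain φ θ (i + 1) η, transferChain_mem_supportedOn φ θ _ η,
      diff_transferChain hφ θ hθ i η⟩

variable {N' : Submodule k L} {N : Submodule k M} (hN : ∀ m, θ m ∈ N ↔ m ∈ N')

include hN

theorem transferChain_mem_cyclesIn_iff {i : ℕ} {ω : Chain k W L i} :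
    transferChain φ θ i ω ∈ cyclesIn (Finset.univ.image φ) N i ↔
      ω ∈ cyclesIn Finset.univ N' i := by
  rw [mem_cyclesIn, mem_cyclesIn, transferChain_mem_cycles_iff hφ θ hθ]
  refine ⟨fun ⟨_, h1, h2⟩ => ⟨mem_supportedOn_univ ω, h1, fun u => ?_⟩,
    fun ⟨_, h1, h2⟩ => ⟨transferChain_mem_supportedOn φ θ i ω, h1, fun u => (hN _).2 (h2 _)⟩⟩
  rw [← hN]
  -- Every value of `ω` is a value of its transfer, taken at the vectors extended by zero.
  have := h2 fun j => Function.ExtendByZero.linearMap k φ (u j)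
  rw [transferChain_apply] at this
  convert this using 5 with j
  ext w
  simp [Function.ExtendByZero.linearMap_apply, hφ.extend_apply]

theorem cyclesIn_image_le {i : ℕ}
    (h : cyclesIn (Finset.univ : Finset W) N' i ≤ boundariesIn k L Finset.univ i) :
    cyclesIn (Finset.univ.image φ) N i ≤ boundariesIn k M (Finset.univ.image φ) i := by
  intro ψ hψ
  obtain ⟨ω, rfl⟩ := exists_transferChain_eq hφ θ (mem_cyclesIn.1 hψ).1
  rw [transferChain_mem_cyclesIn_iff hφ θ hθ hN] at hψ
  exact (transferChain_mem_boundariesIn_iff hφ θ hθ).2 (h hψ)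

theorem relDim_cyclesIn_image (i : ℕ) :
    relDim (boundariesIn k M (Finset.univ.image φ) i) (cyclesIn (Finset.univ.image φ) N i) =
      relDim (boundariesIn k L (Finset.univ : Finset W) i) (cyclesIn Finset.univ N' i) := by
  symm
  refine relDim_eq_of_map (transferChain φ θ i)
    (fun ω hω => (transferChain_mem_cyclesIn_iff hφ θ hθ hN).2 hω) (fun ψ hψ => ?_)
    (fun ω _ => transferChain_mem_boundariesIn_iff hφ θ hθ)
  obtain ⟨ω, rfl⟩ := exists_transferChain_eq hφ θ (mem_cyclesIn.1 hψ).1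
  refine ⟨ω, (transferChain_mem_cyclesIn_iff hφ θ hθ hN).1 hψ, ?_⟩
  rw [sub_self]
  exact Submodule.zero_mem _

end Transfer

end ChangeOfVariables

end GradedTor

/-! ### The long exact sequence of a fibre product. -/

theorem relDim_prod {k : Type*} [Field k] {C C' : Type*} [AddCommGroup C] [Module k C]
    [AddCommGroup C'] [Module k C'] (B Z : Submodule k C) (B' Z' : Submodule k C')
    [Module.Finite k (Z ⧸ B.submoduleOf Z)] [Module.Finite k (Z' ⧸ B'.submoduleOf Z')] :
    relDim (B.prod B') (Z.prod Z') = relDim B Z + relDim B' Z' := by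
  have h : relDim (B.prod B') (Z.prod Z') =
      Module.finrank k ((Z ⧸ B.submoduleOf Z) × (Z' ⧸ B'.submoduleOf Z')) := by
    refine relDim_eq_finrank_of_surjective
      (((B.submoduleOf Z).mkQ ∘ₗ (LinearMap.fst k C C').restrict
          fun x (hx : x ∈ Z.prod Z') => hx.1).prod
        ((B'.submoduleOf Z').mkQ ∘ₗ (LinearMap.snd k C C').restrict
          fun x (hx : x ∈ Z.prod Z') => hx.2)) ?_ ?_
    · rintro ⟨q, q'⟩
      obtain ⟨z, rfl⟩ := Submodule.mkQ_surjective _ q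
      obtain ⟨z', rfl⟩ := Submodule.mkQ_surjective _ q'
      exact ⟨⟨(z, z'), z.2, z'.2⟩, rfl⟩
    · intro z
      exact Prod.mk_eq_zero.trans
        (and_congr (Submodule.Quotient.mk_eq_zero _) (Submodule.Quotient.mk_eq_zero _))
  rw [h, Module.finrank_prod, relDim, relDim]

namespace GradedTor

set_option linter.unusedSectionVars false

open MvPolynomial

section Pullback

variable {k : Type*} [Field k] {V : Type*} [Fintype V] [DecidableEq V]

theorem exists_compAlternatingMap_eq {M M' : Type*} [AddCommGroup M] [Module k M]
    [AddCommGroup M'] [Module k M'] (f : M →ₗ[k] M') {i : ℕ} (ω : (V → k) [⋀^Fin i]→ₗ[k] M')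
    (h : ∀ u, ω u ∈ LinearMap.range f) : ∃ η, f.compAlternatingMap η = ω := by
  obtain ⟨g, hg⟩ := f.exists_section_on_range
  exact ⟨g.compAlternatingMap ω, AlternatingMap.ext fun u => hg _ (h u)⟩

variable
  {M : Type*} [AddCommGroup M] [Module (MvPolynomial V k) M]
  [Module k M] [IsScalarTower k (MvPolynomial V k) M]
  {M₁ : Type*} [AddCommGroup M₁] [Module (MvPolynomial V k) M₁]
  [Module k M₁] [IsScalarTower k (MvPolynomial V k) M₁]
  {M₂ : Type*} [AddCommGroup M₂] [Module (MvPolynomial V k) M₂]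
  [Module k M₂] [IsScalarTower k (MvPolynomial V k) M₂]
  {M₃ : Type*} [AddCommGroup M₃] [Module (MvPolynomial V k) M₃]
  [Module k M₃] [IsScalarTower k (MvPolynomial V k) M₃]

/-- The map of chains that is induced by a map of modules. -/
noncomputable def mapChain (f : M →ₗ[MvPolynomial V k] M₁) (i : ℕ) : Chain k V M i →ₗ[k] Chain k V M₁ i where
  toFun ω := (f.restrictScalars k).compAlternatingMap ω
  map_add' _ _ := LinearMap.compAlternatingMap_add _ _ _
  map_smul' _ _ := LinearMap.compAlternatingMap_smul _ _ _

theorem diff_restrictScalars_comp (f : M →ₗ[MvPolynomial V k] M₁) (i : ℕ)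
    (ω : Chain k V M (i + 1)) :
    diff k V M₁ i ((f.restrictScalars k).compAlternatingMap ω) =
      (f.restrictScalars k).compAlternatingMap (diff k V M i ω) :=
  diff_compAlternatingMap _ (fun v m => f.map_smul (X v) m) i ω

variable {f₁ : M →ₗ[MvPolynomial V k] M₁} {f₂ : M →ₗ[MvPolynomial V k] M₂}
  {g₁ : M₁ →ₗ[MvPolynomial V k] M₃} {g₂ : M₂ →ₗ[MvPolynomial V k] M₃}

/-- The hypothesis `hex` is exactness of `M → M₁ ⊕ M₂ → M₃` in the middle, and `hinj`, used below,
is exactness on the left. Both pass to chains by lifting along `M → M₁ ⊕ M₂`. -/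
theorem exists_chain_of_pullback
    (hex : ∀ a b, g₁ a = g₂ b → ∃ m, f₁ m = a ∧ f₂ m = b) {i : ℕ}
    {ω₁ : Chain k V M₁ i} {ω₂ : Chain k V M₂ i}
    (h : (g₁.restrictScalars k).compAlternatingMap ω₁ =
      (g₂.restrictScalars k).compAlternatingMap ω₂) :
    ∃ ω : Chain k V M i, (f₁.restrictScalars k).compAlternatingMap ω = ω₁ ∧
      (f₂.restrictScalars k).compAlternatingMap ω = ω₂ := by
  obtain ⟨ω, hω⟩ := exists_compAlternatingMap_eq
    ((f₁.restrictScalars k).prod (f₂.restrictScalars k)) (ω₁.prod ω₂) (fun u => by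
      obtain ⟨m, hm₁, hm₂⟩ := hex (ω₁ u) (ω₂ u) (congrArg (fun η => η u) h)
      exact ⟨m, Prod.ext hm₁ hm₂⟩)
  exact ⟨ω, AlternatingMap.ext fun u => congrArg (fun η => (η u).1) hω,
    AlternatingMap.ext fun u => congrArg (fun η => (η u).2) hω⟩

theorem chain_ext_of_pullback (hinj : ∀ m, f₁ m = 0 → f₂ m = 0 → m = 0) {i : ℕ}
    {ω η : Chain k V M i}
    (h₁ : (f₁.restrictScalars k).compAlternatingMap ω = (f₁.restrictScalars k).compAlternatingMap η)
    (h₂ : (f₂.restrictScalars k).compAlternatingMap ω =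
      (f₂.restrictScalars k).compAlternatingMap η) : ω = η := by
  ext u
  rw [← sub_eq_zero]
  refine hinj _ ?_ ?_
  · rw [map_sub, sub_eq_zero]; exact congrArg (fun η => η u) h₁
  · rw [map_sub, sub_eq_zero]; exact congrArg (fun η => η u) h₂

theorem mem_cycles_of_pullback (hinj : ∀ m, f₁ m = 0 → f₂ m = 0 → m = 0) {i : ℕ}
    {ω : Chain k V M i} (h₁ : (f₁.restrictScalars k).compAlternatingMap ω ∈ cycles k V M₁ i)
    (h₂ : (f₂.restrictScalars k).compAlternatingMap ω ∈ cycles k V M₂ i) :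
    ω ∈ cycles k V M i := by
  cases i with
  | zero => trivial
  | succ i =>
    change diff k V M i ω = 0
    refine chain_ext_of_pullback hinj ?_ ?_
    · rw [← diff_restrictScalars_comp, LinearMap.compAlternatingMap_zero]; exact h₁
    · rw [← diff_restrictScalars_comp, LinearMap.compAlternatingMap_zero]; exact h₂

theorem exists_chain_of_surjective (hg₁ : Function.Surjective g₁) {i : ℕ} (ω : Chain k V M₃ i) :
    ∃ η : Chain k V M₁ i, (g₁.restrictScalars k).compAlternatingMap η = ω :=
  exists_compAlternatingMap_eq (g₁.restrictScalars k) ω (fun u => hg₁ (ω u))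

theorem boundary_apply_mem {N : Submodule k M} (hN : ∀ (v : V) m, (X v : MvPolynomial V k) • m ∈ N)
    {i : ℕ} (η : Chain k V M (i + 1)) (u : Fin i → V → k) : diff k V M i η u ∈ N := by
  rw [diff_apply_apply]
  exact N.sum_mem fun v _ => hN v _

theorem mem_boundariesIn_univ {i : ℕ} {ω : Chain k V M i} :
    ω ∈ boundariesIn k M Finset.univ i ↔ ∃ η, diff k V M i η = ω :=
  ⟨fun ⟨η, _, h⟩ => ⟨η, h⟩, fun ⟨η, h⟩ => ⟨η, mem_supportedOn_univ η, h⟩⟩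

theorem mem_cyclesIn_univ {N : Submodule k M} {i : ℕ} {ω : Chain k V M i} :
    ω ∈ cyclesIn Finset.univ N i ↔ ω ∈ cycles k V M i ∧ ∀ u, ω u ∈ N :=
  ⟨fun h => (mem_cyclesIn.1 h).2, fun h => mem_cyclesIn.2 ⟨mem_supportedOn_univ ω, h⟩⟩

theorem diff_mem_cycles (i : ℕ) (η : Chain k V M (i + 1)) : diff k V M i η ∈ cycles k V M i :=
  boundaries_le_cycles i ⟨η, rfl⟩

variable {N : Submodule k M} {N₁ : Submodule k M₁} {N₂ : Submodule k M₂} {N₃ : Submodule k M₃}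

variable (f₁ f₂) in
/-- The chains that become boundaries in both quotients. -/
noncomputable def boundariesAfter (i : ℕ) : Submodule k (Chain k V M i) :=
  (boundariesIn k M₁ Finset.univ i).comap (mapChain f₁ i) ⊓
    (boundariesIn k M₂ Finset.univ i).comap (mapChain f₂ i)

/-- The right half of the long exact sequence: the classes with values in `N` map onto pairs of
classes, since the obstruction lies in the `N₃`-valued homology of `M₃`, which is zero by `h₃`. -/
theorem relDim_boundariesAfter
    (hinj : ∀ m, f₁ m = 0 → f₂ m = 0 → m = 0)
    (hex : ∀ a b, g₁ a = g₂ b → ∃ m, f₁ m = a ∧ f₂ m = b)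
    (hg₁ : Function.Surjective g₁) {i : ℕ}
    (hN₁ : ∀ m, m ∈ N ↔ f₁ m ∈ N₁) (hN₂ : ∀ m, m ∈ N ↔ f₂ m ∈ N₂)
    (hN₃ : ∀ a, a ∈ N₁ → g₁ a ∈ N₃) (hN₃' : ∀ b, b ∈ N₂ → g₂ b ∈ N₃)
    (h₃ : cyclesIn Finset.univ N₃ i ≤ boundariesIn k M₃ (Finset.univ : Finset V) i)
    [Module.Finite k (cyclesIn (Finset.univ : Finset V) N₁ i ⧸
      (boundariesIn k M₁ Finset.univ i).submoduleOf (cyclesIn (Finset.univ : Finset V) N₁ i))]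
    [Module.Finite k (cyclesIn (Finset.univ : Finset V) N₂ i ⧸
      (boundariesIn k M₂ Finset.univ i).submoduleOf (cyclesIn (Finset.univ : Finset V) N₂ i))] :
    relDim (boundariesAfter f₁ f₂ i) (cyclesIn Finset.univ N i) =
      relDim (boundariesIn k M₁ (Finset.univ : Finset V) i) (cyclesIn Finset.univ N₁ i) +
      relDim (boundariesIn k M₂ (Finset.univ : Finset V) i) (cyclesIn Finset.univ N₂ i) := by
  rw [← relDim_prod]
  let F : Chain k V M i →ₗ[k] Chain k V M₁ i × Chain k V M₂ i :=
    (mapChain f₁ i).prod (mapChain f₂ i)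
  refine relDim_eq_of_map F (fun ω hω => ?_) ?_ (fun ω _ => Iff.rfl)
  · rw [mem_cyclesIn_univ] at hω
    refine ⟨mem_cyclesIn_univ.2 ⟨?_, fun u => (hN₁ _).1 (hω.2 u)⟩,
      mem_cyclesIn_univ.2 ⟨?_, fun u => (hN₂ _).1 (hω.2 u)⟩⟩
    · exact compAlternatingMap_mem_cycles _ (fun v m => f₁.map_smul (X v) m) hω.1
    · exact compAlternatingMap_mem_cycles _ (fun v m => f₂.map_smul (X v) m) hω.1
  · rintro ⟨ω₁, ω₂⟩ ⟨h₁, h₂⟩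
    have h₁ := mem_cyclesIn_univ.1 h₁
    have h₂ := mem_cyclesIn_univ.1 h₂
    have h4 : (g₁.restrictScalars k).compAlternatingMap ω₁ -
        (g₂.restrictScalars k).compAlternatingMap ω₂ ∈ cyclesIn Finset.univ N₃ i := by
      refine mem_cyclesIn_univ.2 ⟨Submodule.sub_mem _
        (compAlternatingMap_mem_cycles _ (fun v m => g₁.map_smul (X v) m) h₁.1)
        (compAlternatingMap_mem_cycles _ (fun v m => g₂.map_smul (X v) m) h₂.1), fun u => ?_⟩
      exact N₃.sub_mem (hN₃ _ (h₁.2 u)) (hN₃' _ (h₂.2 u))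
    obtain ⟨ζ, hζ⟩ := mem_boundariesIn_univ.1 (h₃ h4)
    obtain ⟨ξ, rfl⟩ := exists_chain_of_surjective (k := k) hg₁ ζ
    rw [diff_restrictScalars_comp] at hζ
    -- The difference of the images in `M₃` is the image of `dξ`; replacing `ω₁` by the homologous
    -- `ω₁ - dξ` makes the pair agree in `M₃`.
    obtain ⟨ω, hω₁, hω₂⟩ := exists_chain_of_pullback (k := k) hex
      (ω₁ := ω₁ - diff k V M₁ i ξ) (ω₂ := ω₂) (by
        ext u
        have := congrArg (fun η => η u) hζ
        simp only [LinearMap.compAlternatingMap_apply, AlternatingMap.sub_apply, map_sub] at this ⊢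
        rw [this, sub_sub_cancel])
    refine ⟨ω, mem_cyclesIn_univ.2 ⟨mem_cycles_of_pullback hinj ?_ ?_, fun u => ?_⟩, ?_⟩
    · rw [hω₁]; exact Submodule.sub_mem _ h₁.1 (diff_mem_cycles i ξ)
    · rw [hω₂]; exact h₂.1
    · rw [hN₂]
      have := h₂.2 u
      rwa [← hω₂] at this
    · have hF : F ω = (ω₁ - diff k V M₁ i ξ, ω₂) := Prod.ext hω₁ hω₂
      rw [hF]
      refine ⟨?_, ?_⟩
      · change ω₁ - (ω₁ - diff k V M₁ i ξ) ∈ _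
        rw [sub_sub_cancel]
        exact mem_boundariesIn_univ.2 ⟨ξ, rfl⟩
      · change ω₂ - ω₂ ∈ _
        rw [sub_self]
        exact Submodule.zero_mem _

/-- The left half: the kernel of `H_i(M) → H_i(M₁) ⊕ H_i(M₂)` is `H_{i+1}(M₃)`, because
`H_{i+1}(M₁)` and `H_{i+1}(M₂)` vanish. -/
theorem relDim_connecting
    (hinj : ∀ m, f₁ m = 0 → f₂ m = 0 → m = 0)
    (hcomm : ∀ m, g₁ (f₁ m) = g₂ (f₂ m))
    (hex : ∀ a b, g₁ a = g₂ b → ∃ m, f₁ m = a ∧ f₂ m = b)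
    (hg₁ : Function.Surjective g₁) {i : ℕ}
    (h₁ : cyclesIn Finset.univ ⊤ (i + 1) ≤ boundariesIn k M₁ (Finset.univ : Finset V) (i + 1))
    (h₂ : cyclesIn Finset.univ ⊤ (i + 1) ≤ boundariesIn k M₂ (Finset.univ : Finset V) (i + 1)) :
    relDim (boundariesIn k M Finset.univ i) (boundariesAfter f₁ f₂ i) =
      relDim (boundariesIn k M₃ (Finset.univ : Finset V) (i + 1))
        (cyclesIn Finset.univ ⊤ (i + 1)) := by
  let E := Chain k V M₁ (i + 1) × Chain k V M₂ (i + 1) × Chain k V M i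
  -- `D` is the graph of the connecting map before passing to homology: triples `(ξ₁, ξ₂, ω)` such
  -- that `ω` becomes `dξ₁` in `M₁` and `dξ₂` in `M₂`. The projection `q` returns `ω`, while `p`
  -- gives the cycle `g₁ξ₁ - g₂ξ₂`. Both are onto modulo boundaries, and by `key` boundaries have
  -- the same preimage in `D`, so the two quotients have equal dimension.
  let D : Submodule k E :=
    LinearMap.ker (mapChain f₁ i ∘ₗ LinearMap.snd k _ _ ∘ₗ LinearMap.snd k _ _ -
      (diff k V M₁ i).restrictScalars k ∘ₗ LinearMap.fst k _ _) ⊓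
    LinearMap.ker (mapChain f₂ i ∘ₗ LinearMap.snd k _ _ ∘ₗ LinearMap.snd k _ _ -
      (diff k V M₂ i).restrictScalars k ∘ₗ LinearMap.fst k _ _ ∘ₗ LinearMap.snd k _ _)
  have hD : ∀ ξ₁ ξ₂ ω, (ξ₁, ξ₂, ω) ∈ D ↔
      (f₁.restrictScalars k).compAlternatingMap ω = diff k V M₁ i ξ₁ ∧
        (f₂.restrictScalars k).compAlternatingMap ω = diff k V M₂ i ξ₂ := fun ξ₁ ξ₂ ω =>
    and_congr sub_eq_zero sub_eq_zero
  let p : E →ₗ[k] Chain k V M₃ (i + 1) :=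
    mapChain g₁ (i + 1) ∘ₗ LinearMap.fst k _ _ -
      mapChain g₂ (i + 1) ∘ₗ LinearMap.fst k _ _ ∘ₗ LinearMap.snd k _ _
  let q : E →ₗ[k] Chain k V M i := LinearMap.snd k _ _ ∘ₗ LinearMap.snd k _ _
  have hp : ∀ x, p x = (g₁.restrictScalars k).compAlternatingMap x.1 -
        (g₂.restrictScalars k).compAlternatingMap x.2.1 := fun _ => rfl
  have key : ∀ x ∈ D, p x ∈ boundariesIn k M₃ (Finset.univ : Finset V) (i + 1) ↔
      q x ∈ boundariesIn k M Finset.univ i := by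
    rintro ⟨ξ₁, ξ₂, ω⟩ hx
    obtain ⟨hω₁, hω₂⟩ := (hD _ _ _).1 hx
    change _ ↔ ω ∈ _
    rw [hp, mem_boundariesIn_univ, mem_boundariesIn_univ]
    constructor
    · rintro ⟨ζ, hζ⟩
      obtain ⟨η, rfl⟩ := exists_chain_of_surjective (k := k) hg₁ ζ
      rw [diff_restrictScalars_comp] at hζ
      obtain ⟨χ, hχ₁, hχ₂⟩ := exists_chain_of_pullback (k := k) hex
        (ω₁ := ξ₁ - diff k V M₁ (i + 1) η) (ω₂ := ξ₂) (by
          ext u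
          have := congrArg (fun η => η u) hζ
          simp only [LinearMap.compAlternatingMap_apply, AlternatingMap.sub_apply,
            map_sub] at this ⊢
          rw [this, sub_sub_cancel])
      refine ⟨χ, chain_ext_of_pullback (k := k) hinj ?_ ?_⟩
      · rw [← diff_restrictScalars_comp, hχ₁, map_sub, diff_diff, sub_zero, hω₁]
      · rw [← diff_restrictScalars_comp, hχ₂, hω₂]
    · rintro ⟨χ, rfl⟩
      rw [← diff_restrictScalars_comp] at hω₁ hω₂
      -- The chain `f₁χ - ξ₁` is a cycle in degree `i + 1`, hence a boundary `dη₁`; likewise for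
      -- `M₂`. The contributions of `χ` cancel in `M₃`.
      obtain ⟨η₁, hη₁⟩ := mem_boundariesIn_univ.1 (h₁ (mem_cyclesIn_univ.2
        ⟨show diff k V M₁ i ((f₁.restrictScalars k).compAlternatingMap χ - ξ₁) = 0 by
          rw [map_sub, hω₁, sub_self], fun _ => trivial⟩))
      obtain ⟨η₂, hη₂⟩ := mem_boundariesIn_univ.1 (h₂ (mem_cyclesIn_univ.2
        ⟨show diff k V M₂ i ((f₂.restrictScalars k).compAlternatingMap χ - ξ₂) = 0 by
          rw [map_sub, hω₂, sub_self], fun _ => trivial⟩))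
      refine ⟨(g₂.restrictScalars k).compAlternatingMap η₂ -
        (g₁.restrictScalars k).compAlternatingMap η₁, ?_⟩
      rw [map_sub, diff_restrictScalars_comp, diff_restrictScalars_comp, hη₁, hη₂]
      ext u
      simp [hcomm]
  have e₁ : relDim (D ⊓ (boundariesIn k M₃ (Finset.univ : Finset V) (i + 1)).comap p) D =
      relDim (boundariesIn k M₃ (Finset.univ : Finset V) (i + 1))
        (cyclesIn Finset.univ ⊤ (i + 1)) := by
    refine relDim_eq_of_map p ?_ ?_ (fun x hx => ⟨fun h => ⟨hx, h⟩, fun h => h.2⟩)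
    · rintro ⟨ξ₁, ξ₂, ω⟩ hx
      obtain ⟨hω₁, hω₂⟩ := (hD _ _ _).1 hx
      refine mem_cyclesIn_univ.2 ⟨?_, fun _ => trivial⟩
      change diff k V M₃ i (p _) = 0
      rw [hp, map_sub, diff_restrictScalars_comp, diff_restrictScalars_comp, ← hω₁, ← hω₂]
      ext u
      simp [hcomm]
    · intro ζ hζ
      have hζ' : diff k V M₃ i ζ = 0 := (mem_cyclesIn_univ.1 hζ).1
      obtain ⟨ξ, rfl⟩ := exists_chain_of_surjective (k := k) hg₁ ζ
      rw [diff_restrictScalars_comp] at hζ'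
      obtain ⟨ω, hω₁, hω₂⟩ := exists_chain_of_pullback (k := k) hex
        (ω₁ := diff k V M₁ i ξ) (ω₂ := 0) (by
          rw [hζ', LinearMap.compAlternatingMap_zero])
      refine ⟨(ξ, 0, ω), (hD _ _ _).2 ⟨hω₁, ?_⟩, ?_⟩
      · rw [hω₂, map_zero]
      · rw [hp, LinearMap.compAlternatingMap_zero, sub_zero, sub_self]
        exact Submodule.zero_mem _
  have e₂ : relDim (D ⊓ (boundariesIn k M₃ (Finset.univ : Finset V) (i + 1)).comap p) D =
      relDim (boundariesIn k M Finset.univ i) (boundariesAfter f₁ f₂ i) := by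
    refine relDim_eq_of_map q ?_ ?_ (fun x hx => ?_)
    · rintro ⟨ξ₁, ξ₂, ω⟩ hx
      obtain ⟨hω₁, hω₂⟩ := (hD _ _ _).1 hx
      exact ⟨mem_boundariesIn_univ.2 ⟨ξ₁, hω₁.symm⟩, mem_boundariesIn_univ.2 ⟨ξ₂, hω₂.symm⟩⟩
    · rintro ω ⟨hω₁, hω₂⟩
      obtain ⟨ξ₁, hξ₁⟩ := mem_boundariesIn_univ.1 hω₁
      obtain ⟨ξ₂, hξ₂⟩ := mem_boundariesIn_univ.1 hω₂
      refine ⟨(ξ₁, ξ₂, ω), (hD _ _ _).2 ⟨hξ₁.symm, hξ₂.symm⟩, ?_⟩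
      change ω - ω ∈ _
      rw [sub_self]
      exact Submodule.zero_mem _
    · rw [← key x hx]
      exact ⟨fun h => ⟨hx, h⟩, fun h => h.2⟩
  rw [← e₁, e₂]

/-- The dimension count in the long exact sequence of a fibre product `M = M₁ ×_{M₃} M₂`. -/
theorem relDim_pullback
    (hinj : ∀ m, f₁ m = 0 → f₂ m = 0 → m = 0)
    (hcomm : ∀ m, g₁ (f₁ m) = g₂ (f₂ m))
    (hex : ∀ a b, g₁ a = g₂ b → ∃ m, f₁ m = a ∧ f₂ m = b)
    (hg₁ : Function.Surjective g₁) {i : ℕ}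
    (hN₁ : ∀ m, m ∈ N ↔ f₁ m ∈ N₁) (hN₂ : ∀ m, m ∈ N ↔ f₂ m ∈ N₂)
    (hN₃ : ∀ a, a ∈ N₁ → g₁ a ∈ N₃) (hN₃' : ∀ b, b ∈ N₂ → g₂ b ∈ N₃)
    (hX : ∀ (v : V) m, (X v : MvPolynomial V k) • m ∈ N₂)
    (h₁ : cyclesIn Finset.univ ⊤ (i + 1) ≤ boundariesIn k M₁ (Finset.univ : Finset V) (i + 1))
    (h₂ : cyclesIn Finset.univ ⊤ (i + 1) ≤ boundariesIn k M₂ (Finset.univ : Finset V) (i + 1))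
    (h₃ : cyclesIn Finset.univ N₃ i ≤ boundariesIn k M₃ (Finset.univ : Finset V) i)
    [Module.Finite k (cyclesIn (Finset.univ : Finset V) N i ⧸
      (boundariesIn k M Finset.univ i).submoduleOf (cyclesIn (Finset.univ : Finset V) N i))]
    [Module.Finite k (cyclesIn (Finset.univ : Finset V) N₁ i ⧸
      (boundariesIn k M₁ Finset.univ i).submoduleOf (cyclesIn (Finset.univ : Finset V) N₁ i))]
    [Module.Finite k (cyclesIn (Finset.univ : Finset V) N₂ i ⧸
      (boundariesIn k M₂ Finset.univ i).submoduleOf (cyclesIn (Finset.univ : Finset V) N₂ i))] :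
    relDim (boundariesIn k M (Finset.univ : Finset V) i) (cyclesIn Finset.univ N i) =
      relDim (boundariesIn k M₁ (Finset.univ : Finset V) i) (cyclesIn Finset.univ N₁ i) +
      relDim (boundariesIn k M₂ (Finset.univ : Finset V) i) (cyclesIn Finset.univ N₂ i) +
      relDim (boundariesIn k M₃ (Finset.univ : Finset V) (i + 1))
        (cyclesIn Finset.univ ⊤ (i + 1)) := by
  rw [← relDim_boundariesAfter hinj hex hg₁ hN₁ hN₂ hN₃ hN₃' h₃,
    ← relDim_connecting hinj hcomm hex hg₁ h₁ h₂, add_comm]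
  refine relDim_add (fun ω hω => ?_) (fun ω hω => ?_)
  · obtain ⟨η, rfl⟩ := mem_boundariesIn_univ.1 hω
    exact ⟨mem_boundariesIn_univ.2 ⟨_, diff_restrictScalars_comp f₁ i η⟩,
      mem_boundariesIn_univ.2 ⟨_, diff_restrictScalars_comp f₂ i η⟩⟩
  · obtain ⟨ξ₁, hξ₁⟩ := mem_boundariesIn_univ.1 hω.1
    obtain ⟨ξ₂, hξ₂⟩ := mem_boundariesIn_univ.1 hω.2
    refine mem_cyclesIn_univ.2 ⟨mem_cycles_of_pullback hinj ?_ ?_, fun u => ?_⟩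
    · have := diff_mem_cycles i ξ₁
      rwa [hξ₁] at this
    · have := diff_mem_cycles i ξ₂
      rwa [hξ₂] at this
    -- Membership in `N` can be tested in `M₂`, where the chain is a boundary and so has values in
    -- the span of multiples of the variables.
    · rw [hN₂]
      have := boundary_apply_mem hX ξ₂ u
      rw [hξ₂] at this
      exact this

end Pullback

end GradedTor

open MvPolynomial

/-! ### Stanley–Reisner ideals as monomial ideals attached to families of faces. -/

section FaceIdeal

variable (k : Type*) [Field k] {V W : Type*}

/-- The polynomials without monomials whose support belongs to `P`. -/
noncomputable def faceIdeal [DecidableEq V] (P : LowerSet (Finset V)) :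
    Ideal (MvPolynomial V k) where
  carrier := {p | ∀ m : V →₀ ℕ, m.support ∈ P → p.coeff m = 0}
  add_mem' hp hq m hm := by rw [coeff_add, hp m hm, hq m hm, add_zero]
  zero_mem' _ _ := coeff_zero _
  smul_mem' q p hp m hm := by
    rw [smul_eq_mul, coeff_mul]
    refine Finset.sum_eq_zero fun x hx => ?_
    rw [hp x.2, mul_zero]
    refine P.lower ?_ hm
    rw [← Finset.HasAntidiagonal.mem_antidiagonal.1 hx]
    intro v hv
    simp only [Finsupp.mem_support_iff, Finsupp.add_apply] at hv ⊢
    omega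

variable [DecidableEq V] {k}

theorem monomial_mem_faceIdeal {P : LowerSet (Finset V)} {m : V →₀ ℕ} (hm : m.support ∉ P)
    (a : k) : monomial m a ∈ faceIdeal k P := by
  intro m' hm'
  rw [coeff_monomial, if_neg]
  rintro rfl
  exact hm hm'

theorem X_mem_faceIdeal {P : LowerSet (Finset V)} {v : V} (hv : {v} ∉ P) :
    (X v : MvPolynomial V k) ∈ faceIdeal k P :=
  monomial_mem_faceIdeal (by rwa [Finsupp.support_single v one_ne_zero]) 1

theorem faceIdeal_sup (P Q : LowerSet (Finset V)) :
    faceIdeal k (P ⊔ Q) = faceIdeal k P ⊓ faceIdeal k Q := by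
  ext p
  exact ⟨fun h => ⟨fun m hm => h m (Or.inl hm), fun m hm => h m (Or.inr hm)⟩,
    fun h m hm => hm.elim (h.1 m) (h.2 m)⟩

theorem faceIdeal_antitone {P Q : LowerSet (Finset V)} (h : P ≤ Q) :
    faceIdeal k Q ≤ faceIdeal k P := fun _ hp m hm => hp m (h hm)

/-- A monomial whose support is not in both families misses one of them. Together with
`faceIdeal_antitone` this is `I_P + I_Q = I_{P ∩ Q}`. -/
theorem faceIdeal_inf_le (P Q : LowerSet (Finset V)) :
    faceIdeal k (P ⊓ Q) ≤ faceIdeal k P ⊔ faceIdeal k Q := by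
  intro p hp
  rw [p.as_sum]
  refine Submodule.sum_mem _ fun m hm => ?_
  by_cases h : m.support ∈ P
  · refine Submodule.mem_sup_right (monomial_mem_faceIdeal (fun h' => ?_) _)
    exact mem_support_iff.1 hm (hp m ⟨h, h'⟩)
  · exact Submodule.mem_sup_left (monomial_mem_faceIdeal h _)

theorem faceIdeal_top : faceIdeal k (⊤ : LowerSet (Finset V)) = ⊥ := by
  rw [eq_bot_iff]
  intro p hp
  rw [Ideal.mem_bot]
  ext m
  rw [hp m trivial, coeff_zero]

/-- The faces of a simplicial complex, including the empty one. -/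
def AbstractSimplicialComplex.faceSet {V : Type*} (Δ : AbstractSimplicialComplex V) :
    LowerSet (Finset V) where
  carrier := {F | Δ.IsFace F}
  lower' F G hGF hF := by
    rcases hF with rfl | hF
    · exact Or.inl (Finset.subset_empty.1 hGF)
    · rcases G.eq_empty_or_nonempty with h | h
      · exact Or.inl h
      · exact Or.inr ((Δ.isRelLowerSet_faces hF).2 hGF h)

theorem stanleyReisnerIdeal_eq (Δ : AbstractSimplicialComplex V) :
    Δ.stanleyReisnerIdeal k = faceIdeal k Δ.faceSet := by
  have hprod : ∀ F : Finset V, (∏ v ∈ F, X v : MvPolynomial V k) =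
      monomial (Finsupp.indicator F fun _ _ => 1) 1 := by
    intro F
    rw [monomial_eq, map_one, one_mul, Finsupp.prod_of_support_subset (s := F)]
    · exact Finset.prod_congr rfl fun v hv => by simp [hv]
    · exact Finsupp.support_indicator_subset _ _
    · simp
  have hsupp : ∀ F : Finset V, (Finsupp.indicator F fun _ _ => 1 : V →₀ ℕ).support = F := by
    intro F
    ext v
    simp [Finsupp.indicator_apply]
  apply le_antisymm
  · rw [AbstractSimplicialComplex.stanleyReisnerIdeal, Ideal.span_le]
    rintro p ⟨F, hF, rfl⟩
    rw [hprod]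
    exact monomial_mem_faceIdeal (by rw [hsupp]; exact hF) 1
  · intro p hp
    rw [p.as_sum]
    refine Submodule.sum_mem _ fun m hm => ?_
    have hm' : ¬ Δ.IsFace m.support := fun h => mem_support_iff.1 hm (hp m h)
    have hle : (Finsupp.indicator m.support fun _ _ => 1 : V →₀ ℕ) ≤ m := by
      intro v
      rw [Finsupp.indicator_apply]
      split_ifs with h
      · exact Nat.one_le_iff_ne_zero.2 (Finsupp.mem_support_iff.1 h)
      · exact Nat.zero_le _
    -- A monomial with nonface support is divisible by the squarefree monomial of its support.
    have : monomial m (p.coeff m) = monomial (m - Finsupp.indicator m.support fun _ _ => 1)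
        (p.coeff m) * ∏ v ∈ m.support, X v := by
      rw [hprod, monomial_mul, mul_one, tsub_add_cancel_of_le hle]
    rw [this]
    exact Ideal.mul_mem_left _ _ (Ideal.subset_span ⟨_, hm', rfl⟩)

section Rename

variable [DecidableEq W] {φ : W → V} (hφ : Function.Injective φ) {Q : LowerSet (Finset W)}
  {P : LowerSet (Finset V)} (hP : ∀ F, F ∈ P ↔ ∃ G ∈ Q, G.image φ = F)

include hφ hP

theorem rename_mem_faceIdeal_iff {p : MvPolynomial W k} :
    rename φ p ∈ faceIdeal k P ↔ p ∈ faceIdeal k Q := by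
  constructor
  · intro h m hm
    rw [← coeff_rename_mapDomain φ hφ]
    refine h _ ?_
    rw [Finsupp.mapDomain_support_of_injective hφ]
    exact (hP _).2 ⟨_, hm, rfl⟩
  · intro h m hm
    obtain ⟨G, hG, hGm⟩ := (hP _).1 hm
    have hm' : (m.comapDomain φ hφ.injOn).mapDomain φ = m := by
      refine Finsupp.mapDomain_comapDomain φ hφ m ?_
      rw [← hGm, Finset.coe_image]
      exact Set.image_subset_range _ _
    rw [← hm', coeff_rename_mapDomain φ hφ]
    refine h _ ?_
    rw [← hm', Finsupp.mapDomain_support_of_injective hφ] at hGm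
    rwa [← Finset.image_injective hφ hGm]

omit hφ [DecidableEq W] in
theorem X_mem_faceIdeal_of_notMem_range {v : V} (hv : v ∉ Set.range φ) :
    (X v : MvPolynomial V k) ∈ faceIdeal k P := by
  refine X_mem_faceIdeal fun h => ?_
  obtain ⟨G, -, hG⟩ := (hP _).1 h
  have : v ∈ G.image φ := by rw [hG]; exact Finset.mem_singleton_self v
  obtain ⟨w, -, hw⟩ := Finset.mem_image.1 this
  exact hv ⟨w, hw⟩

omit hφ [DecidableEq W] in
theorem mk_rename_surjective :
    Function.Surjective ((Ideal.Quotient.mkₐ k (faceIdeal k P)).comp (rename φ)) := by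
  intro q
  obtain ⟨p, rfl⟩ := Ideal.Quotient.mkₐ_surjective k (faceIdeal k P) q
  induction p using MvPolynomial.induction_on with
  | C a => exact ⟨C a, by rw [AlgHom.comp_apply, rename_C]⟩
  | add p q hp hq =>
    obtain ⟨a, ha⟩ := hp
    obtain ⟨b, hb⟩ := hq
    exact ⟨a + b, by rw [map_add, map_add, ha, hb]⟩
  | mul_X p v hp =>
    obtain ⟨a, ha⟩ := hp
    by_cases hv : v ∈ Set.range φ
    · obtain ⟨w, rfl⟩ := hv
      exact ⟨a * X w, by rw [map_mul, ha, map_mul, AlgHom.comp_apply, rename_X]⟩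
    · refine ⟨0, ?_⟩
      rw [map_zero, eq_comm]
      exact Ideal.Quotient.eq_zero_iff_mem.2
        (Ideal.mul_mem_left _ _ (X_mem_faceIdeal_of_notMem_range hP hv))

/-- The Stanley–Reisner ring does not depend on the ambient vertex set: variables outside the image
of `φ` lie in the ideal. -/
theorem exists_quotient_faceIdeal_equiv :
    ∃ θ : (MvPolynomial W k ⧸ faceIdeal k Q) ≃ₗ[k] (MvPolynomial V k ⧸ faceIdeal k P),
      ∀ p, θ (Ideal.Quotient.mk _ p) = Ideal.Quotient.mk _ (rename φ p) := by
  have hker : faceIdeal k Q =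
      RingHom.ker ((Ideal.Quotient.mkₐ k (faceIdeal k P)).comp (rename φ)) := by
    ext p
    rw [RingHom.mem_ker, ← rename_mem_faceIdeal_iff hφ hP]
    exact Ideal.Quotient.eq_zero_iff_mem.symm
  exact ⟨((Ideal.quotientEquivAlgOfEq k hker).trans
    (Ideal.quotientKerAlgEquivOfSurjective (mk_rename_surjective hP))).toLinearEquiv,
    fun p => rfl⟩

end Rename

end FaceIdeal

/-! ### Constant and linear coefficients of cycles. -/

section Coefficients

variable {k : Type*} [Field k] {V : Type*}

/-- The coefficient of a monomial, on the quotient by an ideal without elements in which that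
monomial occurs. -/
noncomputable def quotientCoeff (J : Ideal (MvPolynomial V k)) (m : V →₀ ℕ)
    (h : ∀ p ∈ J, p.coeff m = 0) : (MvPolynomial V k ⧸ J) →ₗ[k] k :=
  (Submodule.liftQ (J.restrictScalars k) (lcoeff k m) h) ∘ₗ
    (Submodule.Quotient.restrictScalarsEquiv k J).symm.toLinearMap

theorem quotientCoeff_mk (J : Ideal (MvPolynomial V k)) (m : V →₀ ℕ)
    (h : ∀ p ∈ J, p.coeff m = 0) (p : MvPolynomial V k) :
    quotientCoeff J m h (Ideal.Quotient.mk J p) = p.coeff m := rfl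

/-- The image in `S / J` of the ideal of the variables. -/
noncomputable def irrelevant (J : Ideal (MvPolynomial V k)) :
    Submodule k (MvPolynomial V k ⧸ J) :=
  (LinearMap.ker (lcoeff k (0 : V →₀ ℕ))).map (Ideal.Quotient.mkₐ k J).toLinearMap

variable {J : Ideal (MvPolynomial V k)}

theorem mem_irrelevant_iff (h : ∀ p ∈ J, p.coeff 0 = 0) {q : MvPolynomial V k ⧸ J} :
    q ∈ irrelevant J ↔ quotientCoeff J 0 h q = 0 := by
  obtain ⟨p, rfl⟩ := Ideal.Quotient.mk_surjective q
  refine ⟨?_, fun hp => ⟨p, hp, rfl⟩⟩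
  rintro ⟨p', hp', hpp⟩
  rw [← hpp]
  exact hp'

theorem mk_mem_irrelevant_iff (h : ∀ p ∈ J, p.coeff 0 = 0) {p : MvPolynomial V k} :
    Ideal.Quotient.mk J p ∈ irrelevant J ↔ p.coeff 0 = 0 := mem_irrelevant_iff h

theorem X_smul_mem_irrelevant (v : V) (q : MvPolynomial V k ⧸ J) :
    (X v : MvPolynomial V k) • q ∈ irrelevant J := by
  obtain ⟨p, rfl⟩ := Ideal.Quotient.mk_surjective q
  refine ⟨X v * p, ?_, rfl⟩
  simp [← constantCoeff_eq]

theorem X_smul_quotient_eq_zero {v : V} (h : (X v : MvPolynomial V k) ∈ J)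
    (q : MvPolynomial V k ⧸ J) : (X v : MvPolynomial V k) • q = 0 := by
  obtain ⟨p, rfl⟩ := Ideal.Quotient.mk_surjective q
  exact Ideal.Quotient.eq_zero_iff_mem.2 (Ideal.mul_mem_right p J h)

theorem quotientCoeff_single_X_smul [DecidableEq V] (h₀ : ∀ p ∈ J, p.coeff 0 = 0) {v : V}
    (h : ∀ p ∈ J, p.coeff (Finsupp.single v 1) = 0) (w : V) (q : MvPolynomial V k ⧸ J) :
    quotientCoeff J (Finsupp.single v 1) h ((X w : MvPolynomial V k) • q) =
      if w = v then quotientCoeff J 0 h₀ q else 0 := by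
  obtain ⟨p, rfl⟩ := Ideal.Quotient.mk_surjective q
  change coeff _ (X w * p) = _
  rw [coeff_X_mul']
  by_cases hw : w = v
  · subst hw
    rw [if_pos (by simp), if_pos rfl, tsub_self]
    rfl
  · rw [if_neg (by simp [hw]), if_neg hw]

theorem mem_span_X_of_coeff_zero {p : MvPolynomial V k} (h : p.coeff 0 = 0) :
    p ∈ Ideal.span (Set.range (X : V → MvPolynomial V k)) := by
  rw [← Set.image_univ, mem_ideal_span_X_image]
  intro m hm
  by_contra! hc
  have : m = 0 := by ext v; exact hc v trivial
  exact mem_support_iff.1 hm (this ▸ h)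

end Coefficients

namespace GradedTor

section QuotientRing

variable {k : Type*} [Field k] {V : Type*} [Fintype V] [DecidableEq V]
  {J : Ideal (MvPolynomial V k)}

theorem finrank_tor_eq {M : Type*} [AddCommGroup M] [Module (MvPolynomial V k) M]
    [Module k M] [IsScalarTower k (MvPolynomial V k) M] (i : ℕ) {N : Submodule k M}
    (h : ∀ ω ∈ cycles k V M i, ∀ u, ω u ∈ N) :
    Module.finrank k (Tor k V M i) =
      relDim (boundariesIn k M (Finset.univ : Finset V) i)
        (cyclesIn Finset.univ N i) := by
  symm
  let f : cyclesIn (Finset.univ : Finset V) N i →ₗ[k]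
      cycles k V M i :=
    { toFun := fun ω => ⟨ω, (mem_cyclesIn_univ.1 ω.2).1⟩
      map_add' := fun _ _ => rfl
      map_smul' := fun _ _ => rfl }
  refine relDim_eq_finrank_of_surjective
    (((boundaries k V M i).submoduleOf
      (cycles k V M i)).mkQ.restrictScalars k ∘ₗ f) ?_ ?_
  · intro q
    obtain ⟨ω, rfl⟩ := Submodule.mkQ_surjective _ q
    exact ⟨⟨ω, mem_cyclesIn_univ.2 ⟨ω.2, h _ ω.2⟩⟩, rfl⟩
  · intro ω
    rw [boundariesIn_univ]
    exact Submodule.Quotient.mk_eq_zero _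

/-- Compare coefficients of `x_v` in `∑ x_w ω(e_w, -) = 0`: only `w = v` contributes, with the
constant term of `ω(e_v, -)`. The hypothesis `h` makes the coefficient of `x_v` well defined modulo
`J`. -/
theorem curryLeft_apply_mem_irrelevant (h₀ : ∀ p ∈ J, p.coeff 0 = 0) {v : V}
    (h : ∀ p ∈ J, p.coeff (Finsupp.single v 1) = 0) {i : ℕ}
    {ω : Chain k V (MvPolynomial V k ⧸ J) (i + 1)} (hω : ω ∈ cycles k V _ (i + 1))
    (u : Fin i → V → k) : ω.curryLeft (Pi.single v 1) u ∈ irrelevant J := by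
  rw [mem_irrelevant_iff h₀]
  have h1 : diff k V _ i ω u = 0 := by rw [show diff k V _ i ω = 0 from hω]; rfl
  have h2 := congrArg (quotientCoeff J (Finsupp.single v 1) h) h1
  rw [diff_apply_apply, map_sum, map_zero] at h2
  simpa [quotientCoeff_single_X_smul h₀ h] using h2

theorem apply_mem_irrelevant (h₀ : ∀ p ∈ J, p.coeff 0 = 0)
    (h : ∀ v, ∀ p ∈ J, p.coeff (Finsupp.single v 1) = 0) {i : ℕ}
    {ω : Chain k V (MvPolynomial V k ⧸ J) (i + 1)} (hω : ω ∈ cycles k V _ (i + 1))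
    (u : Fin (i + 1) → V → k) : ω u ∈ irrelevant J := by
  have h1 : ω u = ω.curryLeft (u 0) (Fin.tail u) := by
    rw [AlternatingMap.curryLeft_apply_apply]
    exact congrArg ω (Fin.cons_self_tail u).symm
  have h2 : u 0 = ∑ v, u 0 v • (Pi.single v 1 : V → k) := by
    ext j
    simp [Pi.single_apply]
  rw [h1, h2, map_sum, sum_apply]
  refine Submodule.sum_mem _ fun v _ => ?_
  rw [map_smul]
  exact Submodule.smul_mem _ _ (curryLeft_apply_mem_irrelevant h₀ (h v) hω (Fin.tail u))

theorem mem_boundaries_zero_of_mem_irrelevant {ω : Chain k V (MvPolynomial V k ⧸ J) 0}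
    (h : ω ![] ∈ irrelevant J) : ω ∈ boundaries k V _ 0 := by
  obtain ⟨p, hp, hpω⟩ := h
  obtain ⟨η, hη⟩ := (mem_boundaries_zero_iff
    (AlternatingMap.constOfIsEmpty k (V → k) (Fin 0) p)).2 (mem_span_X_of_coeff_zero hp)
  refine ⟨mapChain J.mkQ 1 η, ?_⟩
  have h1 := diff_restrictScalars_comp J.mkQ 0 η
  rw [hη] at h1
  refine h1.trans ?_
  ext u
  rw [Subsingleton.elim u ![]]
  exact hpω

theorem relDim_eq_zero_of_le {C : Type*} [AddCommGroup C] [Module k C] {B Z : Submodule k C}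
    (h : Z ≤ B) : relDim B Z = 0 := by
  have : Subsingleton (Z ⧸ B.submoduleOf Z) :=
    Submodule.Quotient.subsingleton_iff.2 (Submodule.eq_top_iff'.2 fun z => h z.2)
  exact Module.finrank_zero_of_subsingleton

end QuotientRing

end GradedTor

/-! ### The modified type as Koszul homology with values in the irrelevant ideal. -/

namespace AbstractSimplicialComplex

set_option linter.unusedSectionVars false

open GradedTor

variable {k : Type*} [Field k] {V : Type*} [Fintype V] [DecidableEq V]

theorem coeff_zero_of_mem_stanleyReisnerIdeal (Δ : AbstractSimplicialComplex V)
    (p : MvPolynomial V k) (hp : p ∈ Δ.stanleyReisnerIdeal k) : p.coeff 0 = 0 := by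
  rw [stanleyReisnerIdeal_eq] at hp
  exact hp 0 (Or.inl rfl)

theorem coeff_single_of_mem_stanleyReisnerIdeal (Δ : AbstractSimplicialComplex V) (v : V)
    (p : MvPolynomial V k) (hp : p ∈ Δ.stanleyReisnerIdeal k) :
    p.coeff (Finsupp.single v 1) = 0 := by
  rw [stanleyReisnerIdeal_eq] at hp
  refine hp _ (Or.inr ?_)
  rw [Finsupp.support_single v one_ne_zero]
  exact Δ.singleton_mem v

theorem mem_stanleyReisnerDegree_zero {Δ : AbstractSimplicialComplex V}
    {q : Δ.stanleyReisnerRing k} :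
    q ∈ Δ.stanleyReisnerDegree k 0 ↔ ∃ a : k, Ideal.Quotient.mk _ (C a) = q := by
  have : Δ.stanleyReisnerDegree k 0 = (homogeneousSubmodule V k 0).map
      (Ideal.Quotient.mkₐ k (Δ.stanleyReisnerIdeal k)).toLinearMap := by
    refine le_antisymm (iSup₂_le fun m hm => ?_) (le_iSup₂_of_le 0 rfl le_rfl)
    obtain rfl : m = 0 := by exact_mod_cast hm
    exact le_rfl
  rw [this]
  constructor
  · rintro ⟨p, hp, rfl⟩
    refine ⟨p.coeff 0, ?_⟩
    have : p = C (p.coeff 0) :=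
      totalDegree_eq_zero_iff_eq_C.1 (Nat.le_zero.1 (IsHomogeneous.totalDegree_le hp))
    exact congrArg _ this.symm
  · rintro ⟨a, rfl⟩
    exact ⟨C a, isHomogeneous_C V a, rfl⟩

/-- Chains of internal degree `i` in homological degree `i` have constant values. For `i > 0` a
cycle has no constant terms, as every vertex is a face, so it is zero; for `i = 0` every class is
represented by a constant. -/
theorem torDegree_self (Δ : AbstractSimplicialComplex V) (i : ℕ) :
    torDegree k V (Δ.stanleyReisnerDegree k) i (i : ℤ) = if i = 0 then ⊤ else ⊥ := by
  have h₀ := Δ.coeff_zero_of_mem_stanleyReisnerIdeal (k := k)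
  cases i with
  | zero =>
    rw [if_pos rfl, eq_top_iff]
    rintro q -
    obtain ⟨⟨ω, hω⟩, rfl⟩ := Submodule.mkQ_surjective _ q
    obtain ⟨p, hp⟩ := Ideal.Quotient.mk_surjective (ω ![])
    let η : Chain k V (Δ.stanleyReisnerRing k) 0 :=
      AlternatingMap.constOfIsEmpty k (V → k) (Fin 0) (Ideal.Quotient.mk _ (C (p.coeff 0)))
    refine ⟨⟨η, trivial⟩, fun u => ?_, ?_⟩
    · rw [Nat.cast_zero, sub_zero]
      exact mem_stanleyReisnerDegree_zero.2 ⟨_, rfl⟩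
    · refine (Submodule.Quotient.eq _).2 ?_
      refine mem_boundaries_zero_of_mem_irrelevant ?_
      change Ideal.Quotient.mk _ (C (p.coeff 0)) - ω ![] ∈ _
      rw [← hp, ← map_sub, mk_mem_irrelevant_iff h₀]
      simp
  | succ i =>
    rw [if_neg (Nat.succ_ne_zero i), eq_bot_iff]
    rintro _ ⟨⟨ω, hω⟩, h, rfl⟩
    have h1 : ω = 0 := by
      ext u
      have h2 := apply_mem_irrelevant h₀ Δ.coeff_single_of_mem_stanleyReisnerIdeal hω u
      have h3 := h u
      rw [sub_self] at h3
      obtain ⟨a, ha⟩ := mem_stanleyReisnerDegree_zero.1 h3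
      change _ = ω u at ha
      rw [← ha, mk_mem_irrelevant_iff h₀, coeff_zero_C] at h2
      rw [← ha, h2, map_zero, map_zero]
      rfl
    subst h1
    exact Submodule.zero_mem _

/-- For `i = 0` everything is subtracted and chains with values in the irrelevant ideal are
boundaries. For `i > 0` nothing is subtracted and all cycles already have such values. -/
theorem finrank_tor_sub_finrank_torDegree (Δ : AbstractSimplicialComplex V) (i : ℕ) :
    (Module.finrank k (Tor k V (Δ.stanleyReisnerRing k) i) : ℤ) -
      Module.finrank k (torDegree k V (Δ.stanleyReisnerDegree k) i (i : ℤ)) = relDim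
      (boundariesIn k (Δ.stanleyReisnerRing k) (Finset.univ : Finset V) i)
      (cyclesIn Finset.univ (irrelevant (Δ.stanleyReisnerIdeal k)) i) := by
  rw [torDegree_self]
  cases i with
  | zero =>
    rw [if_pos rfl, finrank_top, sub_self, relDim_eq_zero_of_le, Nat.cast_zero]
    intro ω hω
    rw [boundariesIn_univ]
    exact mem_boundaries_zero_of_mem_irrelevant ((mem_cyclesIn_univ.1 hω).2 _)
  | succ i =>
    rw [if_neg (Nat.succ_ne_zero i), finrank_bot, Nat.cast_zero, sub_zero,
      finrank_tor_eq (i + 1) fun ω hω u => apply_mem_irrelevant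
        Δ.coeff_zero_of_mem_stanleyReisnerIdeal Δ.coeff_single_of_mem_stanleyReisnerIdeal hω u]

/-- The modified type counts the cycles with values in the irrelevant ideal modulo boundaries. -/
theorem modifiedType_eq_relDim (Δ : AbstractSimplicialComplex V) :
    Δ.modifiedType k = relDim
      (boundariesIn k (Δ.stanleyReisnerRing k) (Finset.univ : Finset V) Δ.codim)
      (cyclesIn Finset.univ (irrelevant (Δ.stanleyReisnerIdeal k)) Δ.codim) :=
  Δ.finrank_tor_sub_finrank_torDegree Δ.codim

end AbstractSimplicialComplex

namespace GradedTor

set_option linter.unusedSectionVars false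

/-! ### Finite dimension of Koszul homology. -/

section Finiteness

variable {k : Type*} [Field k] {V : Type*} [Fintype V] [DecidableEq V]
  {M : Type*} [AddCommGroup M] [Module (MvPolynomial V k) M]
  [Module k M] [IsScalarTower k (MvPolynomial V k) M]

theorem sub_C_coeff_zero_mem_span_X (p : MvPolynomial V k) :
    p - C (p.coeff 0) ∈ Ideal.span (Set.range (X : V → MvPolynomial V k)) :=
  mem_span_X_of_coeff_zero (by simp)

theorem smul_mem_boundaries_of_mem_span_X {i : ℕ} {ω : Chain k V M i}
    (h : ω ∈ cycles k V M i) {p : MvPolynomial V k}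
    (hp : p ∈ Ideal.span (Set.range (X : V → MvPolynomial V k))) :
    p • ω ∈ boundaries k V M i := by
  induction hp using Submodule.span_induction with
  | mem p hp =>
    obtain ⟨v, rfl⟩ := hp
    exact X_smul_mem_boundaries h v
  | zero => rw [zero_smul]; exact Submodule.zero_mem _
  | add p q _ _ hp hq => rw [add_smul]; exact Submodule.add_mem _ hp hq
  | smul a p _ hp => rw [smul_assoc]; exact Submodule.smul_mem _ a hp

instance isNoetherian_chain [IsNoetherian (MvPolynomial V k) M] (i : ℕ) :
    IsNoetherian (MvPolynomial V k) (Chain k V M i) := by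
  let f : Chain k V M i →ₗ[MvPolynomial V k] ((Fin i → V) → M) :=
    { toFun := fun ω v => ω fun j => Pi.single (v j) 1
      map_add' := fun _ _ => rfl
      map_smul' := fun _ _ => rfl }
  refine isNoetherian_of_injective f ((injective_iff_map_eq_zero f).2 fun ω hω => ?_)
  refine Module.Basis.ext_alternating (Pi.basisFun k V) fun v _ => ?_
  simpa [f] using congrFun hω v

theorem finite_tor [Module.Finite (MvPolynomial V k) M] (i : ℕ) :
    Module.Finite k (Tor k V M i) := by
  obtain ⟨s, hs⟩ := (inferInstance : Module.Finite (MvPolynomial V k) (Tor k V M i))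
  refine ⟨s, ?_⟩
  rw [eq_top_iff]
  rintro t -
  have ht : t ∈ Submodule.span (MvPolynomial V k) (s : Set (Tor k V M i)) := by rw [hs]; trivial
  induction ht using Submodule.span_induction with
  | mem t ht => exact Submodule.subset_span ht
  | zero => exact Submodule.zero_mem _
  | add t t' _ _ h h' => exact Submodule.add_mem _ h h'
  | smul p t _ h =>
    -- Variables kill homology, so `S` acts through constant coefficients and generators over `S`
    -- also generate over `k`.
    have : p • t = p.coeff 0 • t := by
      obtain ⟨ω, rfl⟩ := Submodule.mkQ_surjective _ t
      rw [← sub_eq_zero, ← algebraMap_smul (MvPolynomial V k) (p.coeff 0), ← sub_smul,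
        ← map_smul]
      exact (Submodule.Quotient.mk_eq_zero _).2
        (smul_mem_boundaries_of_mem_span_X ω.2 (sub_C_coeff_zero_mem_span_X p))
    rw [this]
    exact Submodule.smul_mem _ _ h

instance finite_cyclesIn_quotient [Module.Finite (MvPolynomial V k) M] (N : Submodule k M)
    (i : ℕ) : Module.Finite k (cyclesIn (Finset.univ : Finset V) N i ⧸
      (boundariesIn k M Finset.univ i).submoduleOf (cyclesIn (Finset.univ : Finset V) N i)) := by
  have := finite_tor (k := k) (V := V) (M := M) i
  let f : cyclesIn (Finset.univ : Finset V) N i →ₗ[k] cycles k V M i :=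
    { toFun := fun ω => ⟨ω, (mem_cyclesIn_univ.1 ω.2).1⟩
      map_add' := fun _ _ => rfl
      map_smul' := fun _ _ => rfl }
  let g : cyclesIn (Finset.univ : Finset V) N i →ₗ[k] Tor k V M i :=
    ((boundaries k V M i).submoduleOf (cycles k V M i)).mkQ.restrictScalars k ∘ₗ f
  have hg : LinearMap.ker g = (boundariesIn k M Finset.univ i).submoduleOf
      (cyclesIn (Finset.univ : Finset V) N i) := by
    rw [boundariesIn_univ]
    ext ω
    exact Submodule.Quotient.mk_eq_zero _
  rw [← hg]
  exact Module.Finite.equiv g.quotKerEquivRange.symm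

end Finiteness

/-! ### The Koszul homology of a simplex. -/

section Simplex

variable {k : Type*} [Field k] {V : Type*} [Fintype V] [DecidableEq V] (E : Finset V)

theorem finrank_alternatingMap (W : Type*) [Fintype W] (i : ℕ) :
    Module.finrank k ((W → k) [⋀^Fin i]→ₗ[k] k) = (Fintype.card W).choose i := by
  rw [(exteriorPower.alternatingMapLinearEquiv (R := k) (M := W → k) (N := k)
    (n := i)).finrank_eq]
  rw [← Module.finrank_fintype_fun_eq_card k (η := W), ← exteriorPower.finrank_eq k]
  exact Subspace.dual_finrank_eq

theorem cyclesIn_polynomial_le (i : ℕ) :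
    cyclesIn (Finset.univ : Finset V) (LinearMap.ker (lcoeff k (0 : V →₀ ℕ))) i ≤
      boundariesIn k (MvPolynomial V k) Finset.univ i := by
  intro ω hω
  rw [mem_cyclesIn_univ] at hω
  rw [boundariesIn_univ, Submodule.restrictScalars_mem]
  cases i with
  | zero => exact (mem_boundaries_zero_iff ω).2 (mem_span_X_of_coeff_zero (hω.2 _))
  | succ i => rw [← cycles_eq_boundaries]; exact hω.1

theorem coeff_zero_of_mem_faceIdeal {P : LowerSet (Finset V)} (h : ∅ ∈ P)
    (p : MvPolynomial V k) (hp : p ∈ faceIdeal k P) : p.coeff 0 = 0 := hp 0 h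

theorem coeff_single_of_mem_faceIdeal {P : LowerSet (Finset V)} {v : V} (h : {v} ∈ P)
    (p : MvPolynomial V k) (hp : p ∈ faceIdeal k P) : p.coeff (Finsupp.single v 1) = 0 :=
  hp _ (by rwa [Finsupp.support_single v one_ne_zero])

theorem X_smul_simplex_eq_zero {v : V} (hv : v ∉ E)
    (q : MvPolynomial V k ⧸ faceIdeal k (LowerSet.Iic E)) :
    (X v : MvPolynomial V k) • q = 0 :=
  X_smul_quotient_eq_zero (X_mem_faceIdeal fun h => hv (Finset.singleton_subset_iff.1 h)) q

/-- The linear strand is the only homology of the Stanley-Reisner ring of a simplex. -/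
theorem cyclesIn_simplex_le (i : ℕ) :
    cyclesIn (Finset.univ : Finset V) (irrelevant (faceIdeal k (LowerSet.Iic E))) i ≤
      boundariesIn k (MvPolynomial V k ⧸ faceIdeal k (LowerSet.Iic E)) Finset.univ i := by
  let φ : E → V := Subtype.val
  have hφ : Function.Injective φ := Subtype.val_injective
  have himg : (Finset.univ : Finset E).image φ = E := by ext; simp [φ]
  obtain ⟨θ, hθ⟩ := exists_quotient_faceIdeal_equiv (k := k) hφ (Q := ⊤) (P := LowerSet.Iic E)
    (fun F => ⟨fun hF => ⟨F.subtype (· ∈ E), trivial, by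
      ext v
      simpa [φ] using fun hv => hF hv⟩, by
      rintro ⟨G, -, rfl⟩
      exact (Finset.image_subset_image (Finset.subset_univ G)).trans himg.le⟩)
  let θ' : MvPolynomial E k ≃ₗ[k] (MvPolynomial V k ⧸ faceIdeal k (LowerSet.Iic E)) :=
    ((Submodule.quotEquivOfEqBot (faceIdeal k (⊤ : LowerSet (Finset E)))
      faceIdeal_top).symm.restrictScalars k).trans θ
  have hθ' : ∀ p, θ' p = Ideal.Quotient.mk _ (rename φ p) := hθ
  have h₀ := coeff_zero_of_mem_faceIdeal (k := k) (P := LowerSet.Iic E) (Finset.empty_subset E)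
  -- Modulo the ideal of the simplex the ring is the polynomial ring on `E`, with exact Koszul
  -- complex up to constants in degree `0`; the variables outside `E` act as zero and are adjoined
  -- one by one.
  have key := cyclesIn_union_le_of_forall (T := E) (U := Eᶜ)
    (N := irrelevant (faceIdeal k (LowerSet.Iic E)))
    (fun w hw q => X_smul_simplex_eq_zero E (Finset.mem_compl.1 hw) q) (fun j => by
      have := cyclesIn_image_le hφ θ' (N' := LinearMap.ker (lcoeff k (0 : E →₀ ℕ)))
        (N := irrelevant (faceIdeal k (LowerSet.Iic E))) (i := j) (fun w p => ?_) (fun p => ?_)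
        (cyclesIn_polynomial_le j)
      · rwa [himg] at this
      · rw [hθ', hθ', smul_eq_mul, map_mul, rename_X]
        rfl
      · rw [hθ', mk_mem_irrelevant_iff h₀, ← constantCoeff_eq, constantCoeff_rename]
        rfl) i
  rwa [Finset.union_comm, Finset.union_compl] at key

/-- A homology class is determined by the constant terms of a cycle on the basis vectors outside
`E`, and any alternating form in those coordinates occurs. -/
theorem relDim_simplex (i : ℕ) :
    relDim (boundariesIn k (MvPolynomial V k ⧸ faceIdeal k (LowerSet.Iic E))
        (Finset.univ : Finset V) i) (cyclesIn Finset.univ ⊤ i) =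
      (Fintype.card V - E.card).choose i := by
  set J := faceIdeal k (LowerSet.Iic E) with hJ
  have h₀ := coeff_zero_of_mem_faceIdeal (k := k) (P := LowerSet.Iic E) (Finset.empty_subset E)
  have hval : Function.Injective (Subtype.val : {v // v ∉ E} → V) := Subtype.val_injective
  rw [show Fintype.card V - E.card = Fintype.card {v // v ∉ E} by
    rw [Fintype.card_subtype_compl, Fintype.card_coe], ← finrank_alternatingMap (k := k)]
  let f : Chain k V (MvPolynomial V k ⧸ J) i →ₗ[k] ({v // v ∉ E} → k) [⋀^Fin i]→ₗ[k] k :=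
    { toFun := fun ω => ((quotientCoeff J 0 h₀).compAlternatingMap ω).compLinearMap
        (Function.ExtendByZero.linearMap k Subtype.val)
      map_add' := fun _ _ => by ext; simp
      map_smul' := fun _ _ => by ext; simp }
  refine relDim_eq_finrank_of_surjective
    (f ∘ₗ (cyclesIn (Finset.univ : Finset V) ⊤ i).subtype) (fun a => ?_) (fun ω => ⟨?_, ?_⟩)
  -- A form in the coordinates outside `E`, taken with constant values, is a cycle: for `v ∈ E` it
  -- vanishes on `e_v`, and for `v ∉ E` the variable `x_v` acts as zero.
  · let ω : Chain k V (MvPolynomial V k ⧸ J) i :=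
      ((Algebra.linearMap k (MvPolynomial V k ⧸ J)).compAlternatingMap a).compLinearMap
        (LinearMap.funLeft k k Subtype.val)
    refine ⟨⟨ω, mem_cyclesIn_univ.2 ⟨?_, fun _ => trivial⟩⟩, ?_⟩
    · cases i with
      | zero => trivial
      | succ i =>
        change diff k V _ i ω = 0
        refine AlternatingMap.ext fun u => ?_
        rw [diff_apply_apply]
        refine Finset.sum_eq_zero fun v _ => ?_
        by_cases hv : v ∈ E
        · have h1 : ω (Matrix.vecCons (Pi.single v 1) u) = 0 := by
            change algebraMap k (MvPolynomial V k ⧸ J) (a _) = 0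
            rw [a.map_coord_zero 0, map_zero]
            exact single_comp_of_notMem (by simpa using hv)
          rw [h1, smul_zero]
        · exact X_smul_simplex_eq_zero E hv _
    · refine AlternatingMap.ext fun u => ?_
      change quotientCoeff J 0 h₀ (Ideal.Quotient.mk J (C (a _))) = _
      rw [quotientCoeff_mk, coeff_zero_C]
      congr 1
      funext j w
      exact hval.extend_apply _ _ w
  · intro h
    refine cyclesIn_simplex_le E i (mem_cyclesIn_univ.2 ⟨(mem_cyclesIn_univ.1 ω.2).1, fun u => ?_⟩)
    rw [mem_irrelevant_iff h₀]
    -- On basis vectors meeting `E` constant terms vanish since `ω` is a cycle; on the others they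
    -- vanish by `h`. So `ω` has values in the irrelevant ideal and bounds.
    have : (quotientCoeff J 0 h₀).compAlternatingMap (ω : Chain k V _ i) = 0 := by
      refine Module.Basis.ext_alternating (Pi.basisFun k V) fun v _ => ?_
      by_cases hv : ∃ j, v j ∈ E
      · obtain ⟨j, hj⟩ := hv
        cases i with
        | zero => exact j.elim0
        | succ i =>
          refine apply_eq_zero_of_curryLeft (x := Pi.single (v j) 1) ?_ (j := j) (by simp)
          refine AlternatingMap.ext fun u => ?_
          exact (mem_irrelevant_iff h₀).1 (curryLeft_apply_mem_irrelevant h₀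
            (coeff_single_of_mem_faceIdeal (Finset.singleton_subset_iff.2 hj))
            (mem_cyclesIn_univ.1 ω.2).1 u)
      · push Not at hv
        have h1 := congrArg (fun η => η fun j => Pi.single ⟨v j, hv j⟩ 1) h
        have h2 : (fun j => Pi.basisFun k V (v j)) = fun j =>
            Function.ExtendByZero.linearMap k (Subtype.val : {v // v ∉ E} → V)
              (Pi.single ⟨v j, hv j⟩ (1 : k)) := by
          funext j w
          by_cases hw : w ∈ E
          · rw [Function.ExtendByZero.linearMap_apply,
              Function.extend_apply' _ _ _ (by simpa using hw), Pi.basisFun_apply,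
              Pi.single_eq_of_ne (fun h : w = v j => hv j (h ▸ hw)), Pi.zero_apply]
          · have := hval.extend_apply (Pi.single ⟨v j, hv j⟩ (1 : k)) 0 ⟨w, hw⟩
            rw [Function.ExtendByZero.linearMap_apply, this]
            simp [Pi.single_apply, Subtype.ext_iff]
        rw [h2]
        exact h1
    exact congrArg (fun η => η u) this
  · intro h
    obtain ⟨η, hη⟩ := mem_boundariesIn_univ.1 h
    refine AlternatingMap.ext fun u => ?_
    have h1 := boundary_apply_mem (fun v q => X_smul_mem_irrelevant (J := J) v q) η
      (fun j => Function.ExtendByZero.linearMap k Subtype.val (u j))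
    rw [hη, mem_irrelevant_iff h₀] at h1
    exact h1

end Simplex

end GradedTor

namespace GradedTor

set_option linter.unusedSectionVars false

/-! ### Regular sequences and vanishing of Koszul homology. -/

section Depth

variable {k : Type*} [Field k] {V : Type*} [Fintype V] [DecidableEq V]

theorem chain_eq_zero_of_card_lt {M : Type*} [AddCommGroup M] [Module k M] {i : ℕ}
    (hi : Fintype.card V < i) (ω : (V → k) [⋀^Fin i]→ₗ[k] M) : ω = 0 := by
  ext u
  refine ω.map_linearDependent u fun h => ?_
  have := h.fintype_card_le_finrank
  rw [Fintype.card_fin, Module.finrank_fintype_fun_eq_card] at this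
  omega

variable {A : Type*} [CommRing A] [Algebra (MvPolynomial V k) A] [Algebra k A]
  [IsScalarTower k (MvPolynomial V k) A]

section Action

variable {M : Type*} [AddCommGroup M] [Module A M]
  [Module (MvPolynomial V k) M] [Module k M] [IsScalarTower k (MvPolynomial V k) M]
  [IsScalarTower k A M] [IsScalarTower (MvPolynomial V k) A M]

theorem lsmul_X_smul (a : A) (v : V) (m : M) :
    Algebra.lsmul k k M a ((X v : MvPolynomial V k) • m) =
      (X v : MvPolynomial V k) • Algebra.lsmul k k M a m := by
  change a • (X v : MvPolynomial V k) • m = (X v : MvPolynomial V k) • a • m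
  rw [← algebraMap_smul A (X v : MvPolynomial V k) m,
    ← algebraMap_smul A (X v : MvPolynomial V k) (a • m), smul_comm]

theorem lsmul_mem_boundaries {r : A}
    (hr : r ∈ Ideal.span (Set.range fun v => algebraMap (MvPolynomial V k) A (X v))) {i : ℕ}
    {ω : Chain k V M i} (hω : ω ∈ cycles k V M i) :
    (Algebra.lsmul k k M r).compAlternatingMap ω ∈ boundaries k V M i := by
  induction hr using Submodule.span_induction with
  | mem r hr =>
    obtain ⟨v, rfl⟩ := hr
    convert X_smul_mem_boundaries hω v using 1
    ext u
    exact algebraMap_smul A (X v : MvPolynomial V k) (ω u)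
  | zero =>
    convert Submodule.zero_mem _ using 1
    ext u
    exact zero_smul A (ω u)
  | add a b _ _ ha hb =>
    convert Submodule.add_mem _ ha hb using 1
    ext u
    exact add_smul a b (ω u)
  | smul a b _ hb =>
    obtain ⟨η, hη⟩ := hb
    refine ⟨(Algebra.lsmul k k M a).compAlternatingMap η, ?_⟩
    rw [diff_compAlternatingMap _ (lsmul_X_smul a), hη]
    ext u
    exact (smul_smul a b (ω u))

end Action

open RingTheory.Sequence Pointwise in
/-- Depth sensitivity of the Koszul complex. -/
theorem cycles_le_boundaries_of_isWeaklyRegular {M : Type*} [AddCommGroup M] [Module A M]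
    [Module (MvPolynomial V k) M] [Module k M] [IsScalarTower k (MvPolynomial V k) M]
    [IsScalarTower k A M] [IsScalarTower (MvPolynomial V k) A M] (rs : List A)
    (hrs : ∀ r ∈ rs, r ∈ Ideal.span (Set.range fun v => algebraMap (MvPolynomial V k) A (X v)))
    (hreg : IsWeaklyRegular M rs) (i : ℕ) (hi : Fintype.card V < i + rs.length) :
    cycles k V M i ≤ boundaries k V M i := by
  match rs with
  | [] =>
    intro ω _
    rw [chain_eq_zero_of_card_lt (by simpa using hi) ω]
    exact Submodule.zero_mem _
  | r :: rs =>
    rw [isWeaklyRegular_cons_iff] at hreg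
    -- Dividing by `r` shortens the sequence by one and raises the degree by one, so the inequality
    -- is kept.
    have ih := cycles_le_boundaries_of_isWeaklyRegular (M := QuotSMulTop r M) rs
      (fun s hs => hrs s (List.mem_cons_of_mem _ hs)) hreg.2 (i + 1)
      (by rw [List.length_cons] at hi; omega)
    intro ω hω
    let μ : M →ₗ[k] M := Algebra.lsmul k k M r
    let π : M →ₗ[k] QuotSMulTop r M := (r • (⊤ : Submodule A M)).mkQ.restrictScalars k
    have hπ : ∀ (v : V) m, π ((X v : MvPolynomial V k) • m) =
        (X v : MvPolynomial V k) • π m := fun v m => rfl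
    have hπμ : ∀ m, π (μ m) = 0 := fun m =>
      (Submodule.Quotient.mk_eq_zero _).2 (Submodule.smul_mem_pointwise_smul m r ⊤ trivial)
    -- Since `r` kills homology, `rω = dη`. Modulo `r` the chain `η` is a cycle, hence a boundary,
    -- which gives `η = dξ + rζ`. Then `rω = r dζ`, and `r` can be cancelled.
    obtain ⟨η, hη⟩ := lsmul_mem_boundaries (hrs r List.mem_cons_self) hω
    have hη' : π.compAlternatingMap η ∈ cycles k V (QuotSMulTop r M) (i + 1) := by
      change diff k V _ i _ = 0
      rw [diff_compAlternatingMap π hπ, hη]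
      ext u
      exact hπμ (ω u)
    obtain ⟨ξ', hξ'⟩ := ih hη'
    have hsurj : Function.Surjective π := (r • (⊤ : Submodule A M)).mkQ_surjective
    obtain ⟨ξ, rfl⟩ := exists_compAlternatingMap_eq π ξ' fun u => hsurj (ξ' u)
    rw [diff_compAlternatingMap π hπ] at hξ'
    obtain ⟨ζ, hζ⟩ := exists_compAlternatingMap_eq μ (η - diff k V M (i + 1) ξ) fun u => by
      have h1 : π ((η - diff k V M (i + 1) ξ) u) = 0 := by
        rw [AlternatingMap.sub_apply, map_sub, sub_eq_zero]
        exact (congrArg (fun f => f u) hξ').symm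
      obtain ⟨m, -, hm⟩ := Submodule.mem_smul_pointwise_iff_exists _ _ _ |>.1
        ((Submodule.Quotient.mk_eq_zero _).1 h1)
      exact ⟨m, hm⟩
    refine ⟨ζ, AlternatingMap.ext fun u => hreg.1 ?_⟩
    have h2 := diff_compAlternatingMap μ (lsmul_X_smul r) i ζ
    rw [hζ, map_sub, diff_diff, sub_zero, hη] at h2
    exact (congrArg (fun f => f u) h2).symm

end Depth

/-! ### Localization at the ideal of the variables. -/

section Localization

variable {k : Type*} [Field k] {V : Type*} [Fintype V] [DecidableEq V]
  {M : Type*} [AddCommGroup M] [Module (MvPolynomial V k) M]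
  [Module k M] [IsScalarTower k (MvPolynomial V k) M]
  {A : Type*} [AddCommGroup A] [Module (MvPolynomial V k) A]
  [Module k A] [IsScalarTower k (MvPolynomial V k) A]

/-- On homology `p` acts as its constant coefficient, which is a unit of `k`. -/
theorem mem_boundaries_of_smul_mem {i : ℕ} {ω : Chain k V M i} (hω : ω ∈ cycles k V M i)
    {p : MvPolynomial V k} (hp : p.coeff 0 ≠ 0) (h : p • ω ∈ boundaries k V M i) :
    ω ∈ boundaries k V M i := by
  have h1 := Submodule.sub_mem _ h
    (smul_mem_boundaries_of_mem_span_X hω (sub_C_coeff_zero_mem_span_X p))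
  rw [← sub_smul, sub_sub_cancel] at h1
  have h2 := Submodule.smul_mem _ (C (p.coeff 0)⁻¹) h1
  rwa [← mul_smul, ← C_mul, inv_mul_cancel₀ hp, C_1, one_smul] at h2

/-- Koszul homology does not change under localization at the ideal of the variables. -/
theorem cycles_le_boundaries_of_localization (f : M →ₗ[MvPolynomial V k] A) (i : ℕ)
    (hden : ∀ a : (Fin (i + 1) → V) → A,
      ∃ s : MvPolynomial V k, s.coeff 0 ≠ 0 ∧ ∀ v, ∃ m, f m = s • a v)
    (hker : ∀ m, f m = 0 → ∃ t : MvPolynomial V k, t.coeff 0 ≠ 0 ∧ t • m = 0)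
    (h : cycles k V A i ≤ boundaries k V A i) : cycles k V M i ≤ boundaries k V M i := by
  intro ω hω
  obtain ⟨ξ, hξ⟩ := h (compAlternatingMap_mem_cycles (f.restrictScalars k)
    (fun v q => f.map_smul (X v) q) hω)
  -- A chain is determined by finitely many values on basis vectors, so one denominator `s` serves
  -- for all of them; likewise the product of the `t v` below annihilates the whole of `ψ`.
  obtain ⟨s, hs, hsξ⟩ := hden fun v => ξ fun j => Pi.single (v j) 1
  obtain ⟨g, hg⟩ := (f.restrictScalars k).exists_section_on_range
  let η : Chain k V M (i + 1) := g.compAlternatingMap (s • ξ)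
  have hη : (f.restrictScalars k).compAlternatingMap η = s • ξ := by
    refine Module.Basis.ext_alternating (Pi.basisFun k V) fun v _ => hg _ ?_
    obtain ⟨m, hm⟩ := hsξ v
    refine ⟨m, ?_⟩
    simp only [Pi.basisFun_apply]
    exact hm
  set ψ := s • ω - diff k V _ i η with hψ
  have hzero : ∀ u, f (ψ u) = 0 := by
    intro u
    have h1 := diff_restrictScalars_comp f i η
    rw [hη, map_smul, hξ] at h1
    have h2 := congrArg (fun χ => χ u) h1
    rw [hψ, AlternatingMap.sub_apply, map_sub, sub_eq_zero, AlternatingMap.smul_apply, map_smul]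
    exact h2
  choose t ht htψ using fun v : Fin i → V => hker _ (hzero fun j => Pi.single (v j) 1)
  have hTψ : (∏ v, t v) • ψ = 0 := by
    refine Module.Basis.ext_alternating (Pi.basisFun k V) fun v _ => ?_
    simp only [Pi.basisFun_apply]
    rw [AlternatingMap.smul_apply, ← Finset.prod_erase_mul _ _ (Finset.mem_univ v), mul_smul,
      htψ, smul_zero]
    rfl
  refine mem_boundaries_of_smul_mem hω (p := (∏ v, t v) * s) ?_ ⟨(∏ v, t v) • η, ?_⟩
  · rw [← constantCoeff_eq, map_mul, map_prod]
    exact mul_ne_zero (Finset.prod_ne_zero_iff.2 fun v _ => ht v) hs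
  · rw [hψ, smul_sub, sub_eq_zero] at hTψ
    rw [map_smul, mul_smul, hTψ]

end Localization

end GradedTor

/-! ### The height of the ideal of the variables. -/

section Height

variable {k : Type*} [Field k] {V : Type*} [DecidableEq V] {P : LowerSet (Finset V)}

/-- Setting the variables outside a face to zero. -/
noncomputable def faceEval {T : Finset V} (hT : T ∈ P) :
    (MvPolynomial V k ⧸ faceIdeal k P) →ₐ[k] MvPolynomial V k :=
  Ideal.Quotient.liftₐ (faceIdeal k P) (aeval fun v => if v ∈ T then X v else 0) (by
    intro p hp
    rw [aeval_def, eval₂_eq]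
    refine Finset.sum_eq_zero fun m hm => ?_
    have hmP : ¬ m.support ⊆ T := fun h => mem_support_iff.1 hm (hp m (P.lower h hT))
    obtain ⟨v, hv, hvT⟩ := Finset.not_subset.1 hmP
    rw [Finset.prod_eq_zero hv, mul_zero]
    rw [if_neg hvT, zero_pow (Finsupp.mem_support_iff.1 hv)])

theorem faceEval_mk {T : Finset V} (hT : T ∈ P) (p : MvPolynomial V k) :
    faceEval hT (Ideal.Quotient.mk (faceIdeal k P) p) =
      aeval (fun v => if v ∈ T then (X v : MvPolynomial V k) else 0) p := rfl

theorem ker_faceEval_mono {T T' : Finset V} (hT : T ∈ P) (hT' : T' ∈ P) (h : T' ⊆ T) :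
    RingHom.ker (faceEval (k := k) hT) ≤ RingHom.ker (faceEval (k := k) hT') := by
  intro q hq
  obtain ⟨p, rfl⟩ := Ideal.Quotient.mk_surjective q
  have hcomp : (aeval fun v => if v ∈ T' then (X v : MvPolynomial V k) else 0) =
      (aeval fun v => if v ∈ T' then (X v : MvPolynomial V k) else 0).comp
        (aeval fun v => if v ∈ T then (X v : MvPolynomial V k) else 0) := by
    refine algHom_ext fun v => ?_
    rw [AlgHom.comp_apply, aeval_X, aeval_X]
    by_cases hv : v ∈ T'
    · rw [if_pos hv, if_pos (h hv), aeval_X, if_pos hv]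
    · rw [if_neg hv]
      split_ifs
      · rw [aeval_X, if_neg hv]
      · rw [map_zero]
  rw [RingHom.mem_ker, faceEval_mk] at hq ⊢
  rw [hcomp, AlgHom.comp_apply, hq, map_zero]

/-- Removing the vertices of `F` one at a time gives a chain of `F.card + 1` primes, the kernels of
evaluations into a domain. Each step is strict because the variable of the removed vertex enters the
kernel. -/
theorem card_le_height_ker_faceEval (hP : ∅ ∈ P) {F : Finset V} (hF : F ∈ P) :
    (F.card : ℕ∞) ≤ (RingHom.ker (faceEval (k := k) hP)).height := by
  have key : ∀ U : Finset V, U ⊆ F → ∀ h : F \ U ∈ P,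
      (U.card : ℕ∞) ≤ (RingHom.ker (faceEval (k := k) h)).height := by
    intro U
    induction U using Finset.induction_on with
    | empty => simp
    | insert v U hv ih =>
      intro hUF h
      have h' : F \ U ∈ P := P.lower Finset.sdiff_subset hF
      have hlt : RingHom.ker (faceEval (k := k) h') < RingHom.ker (faceEval (k := k) h) := by
        refine lt_of_le_of_ne (ker_faceEval_mono _ _
          (Finset.sdiff_subset_sdiff le_rfl (Finset.subset_insert v U))) fun heq => ?_
        have h1 : Ideal.Quotient.mk (faceIdeal k P) (X v) ∈ RingHom.ker (faceEval (k := k) h) := by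
          rw [RingHom.mem_ker, faceEval_mk, aeval_X, if_neg (by simp)]
        rw [← heq, RingHom.mem_ker, faceEval_mk, aeval_X,
          if_pos (Finset.mem_sdiff.2 ⟨hUF (Finset.mem_insert_self v U), hv⟩)] at h1
        exact X_ne_zero v h1
      have : (RingHom.ker (faceEval (k := k) h)).IsPrime := RingHom.ker_isPrime _
      have : (RingHom.ker (faceEval (k := k) h')).IsPrime := RingHom.ker_isPrime _
      rw [Finset.card_insert_of_notMem hv, Nat.cast_add, Nat.cast_one]
      exact (add_le_add_left (ih ((Finset.subset_insert v U).trans hUF) h') 1).trans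
        (Ideal.height_add_one_le_of_lt_of_isPrime hlt)
  have h := key F le_rfl (P.lower Finset.sdiff_subset hF)
  convert h using 4
  all_goals simp

end Height

set_option linter.unusedSectionVars false

open GradedTor

/-! ### Vanishing for Cohen–Macaulay complexes. -/

section CohenMacaulay

variable {k : Type*} [Field k] {V : Type*} [Fintype V] [DecidableEq V] {P : LowerSet (Finset V)}

theorem mk_mem_ker_faceEval_empty_iff (hP : ∅ ∈ P) (p : MvPolynomial V k) :
    Ideal.Quotient.mk _ p ∈ RingHom.ker (faceEval (k := k) hP) ↔ p.coeff 0 = 0 := by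
  have : (fun v => if v ∈ (∅ : Finset V) then (X v : MvPolynomial V k) else 0) = 0 := by
    ext1 v; simp
  rw [RingHom.mem_ker, faceEval_mk, this, aeval_zero, algebraMap_eq, C_eq_zero, constantCoeff_eq]

theorem ker_faceEval_empty_le (hP : ∅ ∈ P) : RingHom.ker (faceEval (k := k) hP) ≤
    (Ideal.span (Set.range (X : V → MvPolynomial V k))).map
      (Ideal.Quotient.mk (faceIdeal k P)) := by
  intro q hq
  obtain ⟨p, rfl⟩ := Ideal.Quotient.mk_surjective q
  exact Ideal.mem_map_of_mem _
    (mem_span_X_of_coeff_zero ((mk_mem_ker_faceEval_empty_iff hP p).1 hq))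

/-- Locally at the ideal `m` of the variables there is a regular sequence whose length is the height
of `m`, at least `F.card`. Depth sensitivity gives vanishing there, and localization at `m` loses no
Koszul homology. -/
theorem cycles_faceIdeal_le_boundaries
    (hCM : IsCohenMacaulayRing (MvPolynomial V k ⧸ faceIdeal k P)) {F : Finset V} (hF : F ∈ P)
    {i : ℕ} (hi : Fintype.card V < i + F.card) :
    cycles k V (MvPolynomial V k ⧸ faceIdeal k P) i ≤ boundaries k V _ i := by
  have hP : ∅ ∈ P := P.lower (Finset.empty_subset F) hF
  set m := RingHom.ker (faceEval (k := k) hP) with hm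
  have hprime : m.IsPrime := RingHom.ker_isPrime _
  obtain ⟨rs, hrs, hreg, hlen⟩ := hCM.2 m
  have hcard : F.card ≤ rs.length := by
    rw [IsLocalization.AtPrime.ringKrullDim_eq_height m] at hlen
    have h1 : ((rs.length : ℕ∞) : WithBot ℕ∞) = m.height := hlen
    have h2 := card_le_height_ker_faceEval (k := k) hP hF
    rw [← hm, ← WithBot.coe_inj.1 h1] at h2
    exact_mod_cast h2
  have hnotMem : ∀ p : MvPolynomial V k, Ideal.Quotient.mk _ p ∈ m.primeCompl → p.coeff 0 ≠ 0 :=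
    fun p hp h => hp ((mk_mem_ker_faceEval_empty_iff hP p).2 h)
  refine cycles_le_boundaries_of_localization (A := Localization.AtPrime m)
    (IsScalarTower.toAlgHom (MvPolynomial V k) (MvPolynomial V k ⧸ faceIdeal k P)
      (Localization.AtPrime m)).toLinearMap i (fun a => ?_) (fun q hq => ?_) ?_
  · obtain ⟨b, hb⟩ := IsLocalization.exist_integer_multiples_of_finite m.primeCompl a
    obtain ⟨s, hs⟩ := Ideal.Quotient.mk_surjective (b : MvPolynomial V k ⧸ faceIdeal k P)
    refine ⟨s, hnotMem s (hs ▸ b.2), fun v => ?_⟩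
    obtain ⟨q, hq⟩ := hb v
    rw [← hs] at hq
    exact ⟨q, hq.trans (algebraMap_smul (MvPolynomial V k ⧸ faceIdeal k P) s (a v))⟩
  · obtain ⟨b, hb⟩ := (IsLocalization.map_eq_zero_iff m.primeCompl (Localization.AtPrime m) q).1 hq
    obtain ⟨t, ht⟩ := Ideal.Quotient.mk_surjective (b : MvPolynomial V k ⧸ faceIdeal k P)
    refine ⟨t, hnotMem t (ht ▸ b.2), ?_⟩
    rw [← ht] at hb
    exact hb
  · refine cycles_le_boundaries_of_isWeaklyRegular (A := Localization.AtPrime m) rs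
      (fun r hr => ?_) hreg.toIsWeaklyRegular i (by omega)
    have h1 := hrs r hr
    rw [← Localization.AtPrime.map_eq_maximalIdeal] at h1
    have h2 := Ideal.map_mono (ker_faceEval_empty_le (k := k) hP) h1
    rw [Ideal.map_map, Ideal.map_span, ← Set.range_comp] at h2
    exact h2

end CohenMacaulay

/-! ### Enlarging the vertex set. -/

section ChangeOfVertices

variable {k : Type*} [Field k] {V W : Type*} [Fintype V] [DecidableEq V] [Fintype W]
  [DecidableEq W]

/-- The images of the sets of a family. -/
def imageFaces (φ : W → V) (Q : LowerSet (Finset W)) : LowerSet (Finset V) where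
  carrier := {F | ∃ G ∈ Q, G.image φ = F}
  lower' := by
    rintro _ F' h ⟨G, hG, rfl⟩
    obtain ⟨G', hG', rfl⟩ := Finset.subset_image_iff.1 h
    exact ⟨G', Q.lower (by simpa using hG') hG, rfl⟩

theorem mem_imageFaces {φ : W → V} {Q : LowerSet (Finset W)} {F : Finset V} :
    F ∈ imageFaces φ Q ↔ ∃ G ∈ Q, G.image φ = F := Iff.rfl

theorem empty_mem_imageFaces {φ : W → V} {Q : LowerSet (Finset W)} (h : ∅ ∈ Q) :
    ∅ ∈ imageFaces φ Q := ⟨∅, h, rfl⟩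

variable {φ : W → V} (hφ : Function.Injective φ) {Q : LowerSet (Finset W)} (hQ : ∅ ∈ Q) {c : ℕ}
  (h : ∀ i, c + 1 ≤ i → cyclesIn (Finset.univ : Finset W) ⊤ i ≤
    boundariesIn k (MvPolynomial W k ⧸ faceIdeal k Q) Finset.univ i)

include hφ

theorem card_compl_image : (Finset.univ.image φ)ᶜ.card = Fintype.card V - Fintype.card W := by
  rw [Finset.card_compl, Finset.card_image_of_injective _ hφ, Finset.card_univ]

omit hφ in
theorem X_smul_imageFaces_eq_zero {w : V} (hw : w ∈ (Finset.univ.image φ)ᶜ)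
    (q : MvPolynomial V k ⧸ faceIdeal k (imageFaces φ Q)) : (X w : MvPolynomial V k) • q = 0 :=
  X_smul_quotient_eq_zero (X_mem_faceIdeal_of_notMem_range (Q := Q) (fun _ => mem_imageFaces)
    (by simpa using hw)) q

include h

theorem cyclesIn_image_vertices_le (i : ℕ) (hi : c + 1 ≤ i) :
    cyclesIn (Finset.univ.image φ) ⊤ i ≤
      boundariesIn k (MvPolynomial V k ⧸ faceIdeal k (imageFaces φ Q))
        (Finset.univ.image φ) i := by
  obtain ⟨θ, hθ⟩ := exists_quotient_faceIdeal_equiv (k := k) hφ (Q := Q) (P := imageFaces φ Q)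
    (fun _ => mem_imageFaces)
  refine cyclesIn_image_le hφ θ (N' := ⊤) (fun w q => ?_) (fun _ => Iff.rfl) (h i hi)
  obtain ⟨p, rfl⟩ := Ideal.Quotient.mk_surjective q
  change θ (Ideal.Quotient.mk _ (X w * p)) = _
  rw [hθ, hθ, map_mul, rename_X]
  rfl

theorem cyclesIn_vertices_le (i : ℕ) (hi : c + (Fintype.card V - Fintype.card W) + 1 ≤ i) :
    cyclesIn (Finset.univ : Finset V) ⊤ i ≤
      boundariesIn k (MvPolynomial V k ⧸ faceIdeal k (imageFaces φ Q)) (Finset.univ : Finset V) i := by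
  have := cyclesIn_union_le (T := Finset.univ.image φ) (U := (Finset.univ.image φ)ᶜ)
    (fun w hw q => X_smul_imageFaces_eq_zero hw q) (c + 1)
    (cyclesIn_image_vertices_le hφ h) i (by rw [card_compl_image hφ]; omega)
  rwa [Finset.union_comm, Finset.union_compl] at this

include hQ

/-- `Tor` itself would gain linear classes from the new variables. With values in the irrelevant
ideal, only the shift of the top homology by the number of new vertices remains. -/
theorem relDim_vertices :
    relDim (boundariesIn k (MvPolynomial V k ⧸ faceIdeal k (imageFaces φ Q)) (Finset.univ : Finset V)
        (c + (Fintype.card V - Fintype.card W)))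
      (cyclesIn Finset.univ (irrelevant (faceIdeal k (imageFaces φ Q)))
        (c + (Fintype.card V - Fintype.card W))) =
    relDim (boundariesIn k (MvPolynomial W k ⧸ faceIdeal k Q) (Finset.univ : Finset W) c)
      (cyclesIn Finset.univ (irrelevant (faceIdeal k Q)) c) := by
  obtain ⟨θ, hθ⟩ := exists_quotient_faceIdeal_equiv (k := k) hφ (Q := Q) (P := imageFaces φ Q)
    (fun _ => mem_imageFaces)
  have h1 := relDim_cyclesIn_union (T := Finset.univ.image φ) (U := (Finset.univ.image φ)ᶜ)
    disjoint_compl_left (N := irrelevant (faceIdeal k (imageFaces φ Q)))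
    (fun w hw q => X_smul_imageFaces_eq_zero hw q) c
    (fun i hi ω hω => cyclesIn_image_vertices_le hφ h i hi
      (mem_cyclesIn.2 ⟨(mem_cyclesIn.1 hω).1, (mem_cyclesIn.1 hω).2.1, fun _ => trivial⟩))
  rw [Finset.union_comm, Finset.union_compl, card_compl_image hφ] at h1
  rw [h1]
  refine relDim_cyclesIn_image hφ θ (fun w q => ?_) (fun q => ?_) c
  · obtain ⟨p, rfl⟩ := Ideal.Quotient.mk_surjective q
    change θ (Ideal.Quotient.mk _ (X w * p)) = _
    rw [hθ, hθ, map_mul, rename_X]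
    rfl
  · obtain ⟨p, rfl⟩ := Ideal.Quotient.mk_surjective q
    rw [hθ, mk_mem_irrelevant_iff (coeff_zero_of_mem_faceIdeal hQ),
      mk_mem_irrelevant_iff (coeff_zero_of_mem_faceIdeal (empty_mem_imageFaces hQ)),
      ← constantCoeff_eq, constantCoeff_rename, constantCoeff_eq]

end ChangeOfVertices

/-! ### Mayer–Vietoris for two families that meet in a simplex. -/

section Union

variable {k : Type*} [Field k] {V : Type*} [Fintype V] [DecidableEq V]

theorem relDim_faceIdeal_sup {P Q : LowerSet (Finset V)} (hP : ∅ ∈ P) (hQ : ∅ ∈ Q) {E : Finset V}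
    (hE : P ⊓ Q = LowerSet.Iic E) {c : ℕ}
    (h₁ : cyclesIn (Finset.univ : Finset V) ⊤ (c + 1) ≤
      boundariesIn k (MvPolynomial V k ⧸ faceIdeal k P) (Finset.univ : Finset V) (c + 1))
    (h₂ : cyclesIn (Finset.univ : Finset V) ⊤ (c + 1) ≤
      boundariesIn k (MvPolynomial V k ⧸ faceIdeal k Q) (Finset.univ : Finset V) (c + 1)) :
    relDim (boundariesIn k (MvPolynomial V k ⧸ faceIdeal k (P ⊔ Q)) (Finset.univ : Finset V) c)
      (cyclesIn Finset.univ (irrelevant (faceIdeal k (P ⊔ Q))) c) =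
    relDim (boundariesIn k (MvPolynomial V k ⧸ faceIdeal k P) (Finset.univ : Finset V) c)
      (cyclesIn Finset.univ (irrelevant (faceIdeal k P)) c) +
    relDim (boundariesIn k (MvPolynomial V k ⧸ faceIdeal k Q) (Finset.univ : Finset V) c)
      (cyclesIn Finset.univ (irrelevant (faceIdeal k Q)) c) +
    (Fintype.card V - E.card).choose (c + 1) := by
  rw [← relDim_simplex (k := k) E (c + 1)]
  have hPE : LowerSet.Iic E ≤ P := hE ▸ inf_le_left
  have hQE : LowerSet.Iic E ≤ Q := hE ▸ inf_le_right
  have hPQ := coeff_zero_of_mem_faceIdeal (k := k) (P := P ⊔ Q) (Or.inl hP)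
  have hP0 := coeff_zero_of_mem_faceIdeal (k := k) hP
  have hQ0 := coeff_zero_of_mem_faceIdeal (k := k) hQ
  have hE0 := coeff_zero_of_mem_faceIdeal (k := k) (P := LowerSet.Iic E) (Finset.empty_subset E)
  refine relDim_pullback
    (f₁ := Submodule.factor (faceIdeal_antitone le_sup_left))
    (f₂ := Submodule.factor (faceIdeal_antitone le_sup_right))
    (g₁ := Submodule.factor (faceIdeal_antitone hPE))
    (g₂ := Submodule.factor (faceIdeal_antitone hQE))
    (fun q hq₁ hq₂ => ?_) (fun q => ?_) (fun a b hab => ?_)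
    (Submodule.factor_surjective _) (fun q => ?_) (fun q => ?_) (fun q => ?_) (fun q => ?_)
    (fun v q => X_smul_mem_irrelevant v q) h₁ h₂ (cyclesIn_simplex_le E c)
  · obtain ⟨p, rfl⟩ := Ideal.Quotient.mk_surjective q
    refine Ideal.Quotient.eq_zero_iff_mem.2 ?_
    rw [faceIdeal_sup]
    exact ⟨Ideal.Quotient.eq_zero_iff_mem.1 hq₁, Ideal.Quotient.eq_zero_iff_mem.1 hq₂⟩
  · obtain ⟨p, rfl⟩ := Ideal.Quotient.mk_surjective q
    rfl
  · obtain ⟨a, rfl⟩ := Ideal.Quotient.mk_surjective a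
    obtain ⟨b, rfl⟩ := Ideal.Quotient.mk_surjective b
    have h3 : a - b ∈ faceIdeal k P ⊔ faceIdeal k Q := by
      refine faceIdeal_inf_le P Q ?_
      rw [hE]
      exact Ideal.Quotient.eq.1 hab
    -- With `a - b = x + y`, the element `a - x = b + y` is a common lift.
    obtain ⟨x, hx, y, hy, hxy⟩ := Submodule.mem_sup.1 h3
    refine ⟨Ideal.Quotient.mk _ (a - x), Ideal.Quotient.eq.2 ?_, Ideal.Quotient.eq.2 ?_⟩
    · change a - x - a ∈ _
      rw [sub_sub_cancel_left]
      exact neg_mem hx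
    · change a - x - b ∈ _
      rwa [show a - x - b = y by rw [sub_right_comm, ← hxy, add_sub_cancel_left]]
  · obtain ⟨p, rfl⟩ := Ideal.Quotient.mk_surjective q
    exact (mk_mem_irrelevant_iff hPQ).trans (mk_mem_irrelevant_iff hP0).symm
  · obtain ⟨p, rfl⟩ := Ideal.Quotient.mk_surjective q
    exact (mk_mem_irrelevant_iff hPQ).trans (mk_mem_irrelevant_iff hQ0).symm
  · obtain ⟨p, rfl⟩ := Ideal.Quotient.mk_surjective q
    exact fun hq => (mk_mem_irrelevant_iff hE0).2 ((mk_mem_irrelevant_iff hP0).1 hq)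
  · obtain ⟨p, rfl⟩ := Ideal.Quotient.mk_surjective q
    exact fun hq => (mk_mem_irrelevant_iff hE0).2 ((mk_mem_irrelevant_iff hQ0).1 hq)

end Union

/-! ### Faces, codimension and gluing. -/

namespace AbstractSimplicialComplex

section Faces

variable {V : Type*} [Fintype V] (Δ : AbstractSimplicialComplex V)

theorem card_le_maxFaceCard {F : Finset V} (hF : Δ.IsFace F) : F.card ≤ Δ.maxFaceCard := by
  classical
  rw [maxFaceCard]
  exact Finset.le_sup (f := Finset.card) (by simpa using hF)

theorem exists_card_eq_maxFaceCard : ∃ F, Δ.IsFace F ∧ F.card = Δ.maxFaceCard := by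
  classical
  rw [maxFaceCard]
  obtain ⟨F, hF, h⟩ := Finset.exists_mem_eq_sup
    (Finset.univ.filter fun F : Finset V => Δ.IsFace F) ⟨∅, by rw [Finset.mem_filter]; exact ⟨Finset.mem_univ _, Or.inl rfl⟩⟩ Finset.card
  exact ⟨F, by simpa using hF, h.symm⟩

theorem maxFaceCard_eq {d : ℕ} (h : Δ.dim = (d : ℤ) - 1) : Δ.maxFaceCard = d := by
  rw [dim] at h
  omega

theorem modifiedType_eq_relDim_faceIdeal [DecidableEq V] (k : Type*) [Field k] :
    Δ.modifiedType k = relDim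
      (boundariesIn k (MvPolynomial V k ⧸ faceIdeal k Δ.faceSet) (Finset.univ : Finset V) Δ.codim)
      (cyclesIn Finset.univ (irrelevant (faceIdeal k Δ.faceSet)) Δ.codim) := by
  rw [modifiedType_eq_relDim]
  unfold stanleyReisnerRing
  rw [stanleyReisnerIdeal_eq]

/-- Applied to a face of largest size, the vanishing says that the projective dimension is at most
the codimension. -/
theorem IsCohenMacaulay.cyclesIn_le [DecidableEq V] {k : Type*} [Field k]
    {Δ : AbstractSimplicialComplex V} (hCM : Δ.IsCohenMacaulay k) (i : ℕ)
    (hi : Δ.codim + 1 ≤ i) : cyclesIn (Finset.univ : Finset V) ⊤ i ≤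
      boundariesIn k (MvPolynomial V k ⧸ faceIdeal k Δ.faceSet) Finset.univ i := by
  unfold IsCohenMacaulay stanleyReisnerRing at hCM
  rw [stanleyReisnerIdeal_eq] at hCM
  obtain ⟨F, hF, hcard⟩ := Δ.exists_card_eq_maxFaceCard
  rw [codim, ← hcard] at hi
  intro ω hω
  rw [boundariesIn_univ]
  exact cycles_faceIdeal_le_boundaries hCM hF (by omega) (mem_cyclesIn_univ.1 hω).1

end Faces

section Glue

variable {V₁ V₂ : Type*} [DecidableEq V₁] [DecidableEq V₂]
  {E₁ : Finset V₁} {E₂ : Finset V₂} (e : E₁ ≃ E₂)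

theorem glueRight_injective : Function.Injective (glueRight e) := by
  intro v w h
  unfold glueRight at h
  split_ifs at h with hv hw hw
  · have := e.symm.injective (Subtype.ext (Sum.inl_injective h))
    exact congrArg Subtype.val this
  · exact congrArg Subtype.val (Sum.inr_injective h)

theorem glueRight_eq_inl_iff {v : V₂} {w : V₁} :
    glueRight e v = Sum.inl w ↔ ∃ h : w ∈ E₁, (e ⟨w, h⟩ : V₂) = v := by
  constructor
  · intro h
    unfold glueRight at h
    split_ifs at h with hv
    obtain rfl := Sum.inl_injective h
    exact ⟨(e.symm ⟨v, hv⟩).2, by simp⟩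
  · rintro ⟨h, rfl⟩
    unfold glueRight
    rw [dif_pos (e ⟨w, h⟩).2]
    simp

variable (Δ₁ : AbstractSimplicialComplex V₁) (Δ₂ : AbstractSimplicialComplex V₂)

theorem faceSet_glue : (Δ₁.glue Δ₂ e).faceSet =
    imageFaces Sum.inl Δ₁.faceSet ⊔ imageFaces (glueRight e) Δ₂.faceSet := by
  ext F
  constructor
  · rintro (rfl | ⟨G, hG, rfl⟩ | ⟨G, hG, rfl⟩)
    · exact Or.inl ⟨∅, Or.inl rfl, rfl⟩
    · exact Or.inl ⟨G, Or.inr hG, rfl⟩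
    · exact Or.inr ⟨G, Or.inr hG, rfl⟩
  · rintro (⟨G, rfl | hG, rfl⟩ | ⟨G, rfl | hG, rfl⟩)
    · exact Or.inl rfl
    · exact Or.inr (Or.inl ⟨G, hG, rfl⟩)
    · exact Or.inl rfl
    · exact Or.inr (Or.inr ⟨G, hG, rfl⟩)

theorem image_glueRight_right : E₂.image (glueRight e) = E₁.image Sum.inl := by
  ext x
  simp only [Finset.mem_image]
  constructor
  · rintro ⟨v, hv, rfl⟩
    exact ⟨e.symm ⟨v, hv⟩, (e.symm ⟨v, hv⟩).2, by simp [glueRight, hv]⟩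
  · rintro ⟨w, hw, rfl⟩
    exact ⟨e ⟨w, hw⟩, (e ⟨w, hw⟩).2, (glueRight_eq_inl_iff e).2 ⟨hw, rfl⟩⟩

variable {Δ₁ Δ₂}

/-- The two vertex sets meet exactly in the identified face, so a common face lies in it; conversely
its subsets are faces on both sides. -/
theorem imageFaces_inf_imageFaces (hE₁ : Δ₁.IsFace E₁) (hE₂ : Δ₂.IsFace E₂) :
    imageFaces Sum.inl Δ₁.faceSet ⊓ imageFaces (glueRight e) Δ₂.faceSet =
      LowerSet.Iic (E₁.image Sum.inl) := by
  ext F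
  constructor
  · rintro ⟨⟨G, -, rfl⟩, ⟨G', -, hG'⟩⟩
    refine Finset.image_subset_image fun w hw => ?_
    have : Sum.inl w ∈ G'.image (glueRight e) := by
      rw [hG']; exact Finset.mem_image_of_mem _ hw
    obtain ⟨v, -, hv⟩ := Finset.mem_image.1 this
    exact ((glueRight_eq_inl_iff e).1 hv).1
  · intro hF
    refine ⟨LowerSet.lower _ hF ⟨E₁, hE₁, rfl⟩, LowerSet.lower _ hF ⟨E₂, hE₂, ?_⟩⟩
    exact image_glueRight_right e

theorem maxFaceCard_glue [Fintype V₁] [Fintype V₂] {d : ℕ} (h₁ : Δ₁.maxFaceCard = d)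
    (h₂ : Δ₂.maxFaceCard = d) : (Δ₁.glue Δ₂ e).maxFaceCard = d := by
  apply le_antisymm
  · obtain ⟨F, hF, hcard⟩ := (Δ₁.glue Δ₂ e).exists_card_eq_maxFaceCard
    rw [← hcard]
    have hF' : F ∈ (Δ₁.glue Δ₂ e).faceSet := hF
    rw [faceSet_glue] at hF'
    obtain (⟨G, hG, rfl⟩ | ⟨G, hG, rfl⟩) := hF'
    · exact Finset.card_image_le.trans (h₁ ▸ Δ₁.card_le_maxFaceCard hG)
    · exact Finset.card_image_le.trans (h₂ ▸ Δ₂.card_le_maxFaceCard hG)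
  · obtain ⟨F, hF, hcard⟩ := Δ₁.exists_card_eq_maxFaceCard
    have hF' : F.image (Sum.inl : V₁ → GlueVertex V₁ E₂) ∈ (Δ₁.glue Δ₂ e).faceSet := by
      rw [faceSet_glue]
      exact Or.inl ⟨F, hF, rfl⟩
    rw [← h₁, ← hcard, ← Finset.card_image_of_injective (f := (Sum.inl : V₁ → GlueVertex V₁ E₂)) F
      Sum.inl_injective]
    exact card_le_maxFaceCard _ hF'

end Glue

end AbstractSimplicialComplex

/-! ### The count for the glued complex. -/

theorem mainTheorem4 {k : Type*} [Field k]
    {V₁ V₂ : Type*} [Fintype V₁] [DecidableEq V₁] [Fintype V₂] [DecidableEq V₂]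
    (Δ₁ : AbstractSimplicialComplex V₁) (Δ₂ : AbstractSimplicialComplex V₂)
    (hCM₁ : Δ₁.IsCohenMacaulay k) (hCM₂ : Δ₂.IsCohenMacaulay k)
    (d ℓ : ℕ) (hd₁ : Δ₁.dim = (d : ℤ) - 1) (hd₂ : Δ₂.dim = (d : ℤ) - 1)
    (E₁ : Finset V₁) (E₂ : Finset V₂) (hE₁ : Δ₁.IsFace E₁) (hE₂ : Δ₂.IsFace E₂)
    (hℓ₁ : E₁.card = ℓ) (hℓ₂ : E₂.card = ℓ) (e : E₁ ≃ E₂)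
    (n c : ℕ) (hn : n = Fintype.card (AbstractSimplicialComplex.GlueVertex V₁ E₂))
    (hc : (c : ℤ) = n - d) :
    (Δ₁.glue Δ₂ e).modifiedType k =
        Δ₁.modifiedType k + Δ₂.modifiedType k + ((n - ℓ).choose (c + 1) : ℤ) ∧
      (Δ₁.glue Δ₂ e).typeDefect k =
        Δ₁.typeDefect k + Δ₂.typeDefect k - d + ℓ + ((n - ℓ).choose (c + 1) : ℤ) ∧
      ((d : ℤ) - 1 ≤ ℓ →
        (Δ₁.glue Δ₂ e).typeDefect k = Δ₁.typeDefect k + Δ₂.typeDefect k) := by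
  have hm₁ := Δ₁.maxFaceCard_eq hd₁
  have hm₂ := Δ₂.maxFaceCard_eq hd₂
  have hm := AbstractSimplicialComplex.maxFaceCard_glue e hm₁ hm₂
  have hle₁ : d ≤ Fintype.card V₁ := by
    obtain ⟨F, -, hF⟩ := Δ₁.exists_card_eq_maxFaceCard
    rw [← hm₁, ← hF]
    exact F.card_le_univ
  have hle₂ : d ≤ Fintype.card V₂ := by
    obtain ⟨F, -, hF⟩ := Δ₂.exists_card_eq_maxFaceCard
    rw [← hm₂, ← hF]
    exact F.card_le_univ
  have hℓd : ℓ ≤ d := by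
    rw [← hm₁, ← hℓ₁]
    exact Δ₁.card_le_maxFaceCard hE₁
  have hcard : n + ℓ = Fintype.card V₁ + Fintype.card V₂ := by
    have : ℓ ≤ Fintype.card V₂ := hℓd.trans hle₂
    rw [hn, Fintype.card_sum, Fintype.card_subtype_compl, Fintype.card_coe, hℓ₂]
    omega
  have hc₁ : Δ₁.codim = Fintype.card V₁ - d := by rw [AbstractSimplicialComplex.codim, hm₁]
  have hc₂ : Δ₂.codim = Fintype.card V₂ - d := by rw [AbstractSimplicialComplex.codim, hm₂]
  have hcg : (Δ₁.glue Δ₂ e).codim = c := by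
    rw [AbstractSimplicialComplex.codim, hm, ← hn]
    omega
  -- Each complex has codimension `c` inside the glued vertex set, so both top homologies are moved
  -- to degree `c`.
  have hs₁ : Δ₁.codim + (n - Fintype.card V₁) = c := by omega
  have hs₂ : Δ₂.codim + (n - Fintype.card V₂) = c := by omega
  have hinl : Function.Injective
      (Sum.inl : V₁ → AbstractSimplicialComplex.GlueVertex V₁ E₂) := Sum.inl_injective
  have hglue := AbstractSimplicialComplex.glueRight_injective e
  have htype : (Δ₁.glue Δ₂ e).modifiedType k =
      Δ₁.modifiedType k + Δ₂.modifiedType k + ((n - ℓ).choose (c + 1) : ℤ) := by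
    have he₁ : ∅ ∈ Δ₁.faceSet := Or.inl rfl
    have he₂ : ∅ ∈ Δ₂.faceSet := Or.inl rfl
    have ht₁ := relDim_vertices (k := k) hinl he₁ hCM₁.cyclesIn_le
    have ht₂ := relDim_vertices (k := k) hglue he₂ hCM₂.cyclesIn_le
    have hv₁ := cyclesIn_vertices_le (k := k) hinl hCM₁.cyclesIn_le (c + 1)
      (by rw [← hn, hs₁])
    have hv₂ := cyclesIn_vertices_le (k := k) hglue hCM₂.cyclesIn_le (c + 1)
      (by rw [← hn, hs₂])
    rw [← hn, hs₁] at ht₁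
    rw [← hn, hs₂] at ht₂
    have key := relDim_faceIdeal_sup (empty_mem_imageFaces he₁) (empty_mem_imageFaces he₂)
      (AbstractSimplicialComplex.imageFaces_inf_imageFaces e hE₁ hE₂) hv₁ hv₂
    rw [ht₁, ht₂, ← AbstractSimplicialComplex.faceSet_glue, ← hn,
      Finset.card_image_of_injective _ hinl, hℓ₁] at key
    rw [AbstractSimplicialComplex.modifiedType_eq_relDim_faceIdeal,
      AbstractSimplicialComplex.modifiedType_eq_relDim_faceIdeal,
      AbstractSimplicialComplex.modifiedType_eq_relDim_faceIdeal, hcg, key]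
    push_cast
    rfl
  have hdefect : (Δ₁.glue Δ₂ e).typeDefect k =
      Δ₁.typeDefect k + Δ₂.typeDefect k - d + ℓ + ((n - ℓ).choose (c + 1) : ℤ) := by
    simp only [AbstractSimplicialComplex.typeDefect]
    rw [htype, hcg, hc₁, hc₂]
    push_cast [hle₁, hle₂]
    -- The correction `-d + ℓ` is `codim Δ₁ + codim Δ₂ - c`, because the vertex numbers of the two
    -- pieces add up to `n + ℓ`.
    omega
  refine ⟨htype, hdefect, fun h => ?_⟩
  rw [hdefect]
  -- As `ℓ ≤ d`, only two cases remain. For `ℓ = d` the binomial is `binom(c, c + 1) = 0`; for `ℓ =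
  -- d - 1` it is `binom(c + 1, c + 1) = 1`, which cancels `-d + ℓ = -1`.
  obtain h | h : ℓ = d ∨ ℓ + 1 = d := by omega
  · rw [Nat.choose_eq_zero_of_lt (by omega)]
    push_cast
    omega
  · rw [show n - ℓ = c + 1 by omega, Nat.choose_self]
    push_cast
    omega
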